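/- Let $\mathcal G\rightrightarrows M$ be a (finite-dimensional, smooth) Lie groupoid with source $\mathsf s$, target $\mathsf t$ and composition $g\circ h$ defined when $\mathsf s(g)=\mathsf t(h)$; regard $M$ as the submanifold of units of $\mathcal G$. Let $E=\mathrm{Lie}(\mathcal G)=\mathsf T\mathcal G|_M/\mathsf TM$ be its Lie algebroid. For a smooth section $X$ of $E$ let $X^L$ (resp. $X^R$) be the left-invariant vector field on $\mathcal G$ tangent to the $\mathsf t$-fibres (resp. the right-invariant vector field tangent to the $\mathsf s$-fibres) whose restriction to $M$ represents $X$. Let $F:\mathcal G\to\mathbb R$ be a contrast function, i.e. a smooth function with $F|_M=0$ and $dF|_M=0$, and put $F^*=F\circ\mathrm{inv}$. Let $g^F$ be the symmetric $2$-form on $E$ given by $g^F(X,Y)=\tilde X\tilde YF|_M$, where $\tilde X,\tilde Y$ are any vector fields on $\mathcal G$ whose restrictions to $M$ represent $X,Y$. Assume that $F$ is regular, i.e. that $g^F:E\to E^*$ has constant rank. Let $K^F=\{X\in E: g^F(X,\cdot)=0\}$ be its kernel, $L^F=E/K^F$ the quotient bundle, and $g^{[F]}(\bar X,\bar Y)=g^F(X,Y)$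 the induced non-degenerate form on $L^F$. Assume moreover that $F$ is a Koszul contrast function, i.e. $$X^LY^LZ^RF|_M=0\quad\text{and}\quad X^LY^LZ^RF^*|_M=0$$ for all smooth sections $X,Y$ of $E$ and $Z$ of $K^F$. Then for all smooth sections $X,Y$ of $E$ there is exactly one smooth section $\nabla^F_XY$ of $L^F$, and exactly one smooth section $\nabla^{F^*}_XY$ of $L^F$, such that for every smooth section $Z$ of $E$ $$g^{[F]}(\nabla^F_XY,\bar Z)=X^LY^LZ^RF|_M,\qquad g^{[F]}(\nabla^{F^*}_XY,\bar Z)=X^LY^LZ^RF^*|_M .$$ -/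

import Mathlib

open scoped Manifold ContDiff Topology

noncomputable section

/-- A Lie groupoid `G ⇉ M`: a smooth manifold `G` of arrows, a smooth manifold `M` of units with
unit embedding `unit` (an embedding because it is a smooth section of the source map), smooth
surjective submersions `src`, `tgt`, a composition `mul g h`, meaningful when `src g = tgt h`
(its values on other pairs are irrelevant) and smooth on the set of composable pairs, and an
inverse.  The set of composable pairs is an embedded submanifold of `G × G`, and for a map defined
on it `ContMDiffOn` is the usual smoothness. -/
structure LieGroupoid
    (EM : Type*) [NormedAddCommGroup EM] [NormedSpace ℝ EM]
    (EG : Type*) [NormedAddCommGroup EG] [NormedSpace ℝ EG]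
    (M : Type*) [TopologicalSpace M] [ChartedSpace EM M]
    (G : Type*) [TopologicalSpace G] [ChartedSpace EG G] where
  unit : M → G
  src : G → M
  tgt : G → M
  mul : G → G → G
  inv : G → G
  src_surjective : Function.Surjective src
  tgt_surjective : Function.Surjective tgt
  src_submersion : Manifold.IsSubmersion 𝓘(ℝ, EG) 𝓘(ℝ, EM) ∞ src
  tgt_submersion : Manifold.IsSubmersion 𝓘(ℝ, EG) 𝓘(ℝ, EM) ∞ tgt
  contMDiff_unit : ContMDiff 𝓘(ℝ, EM) 𝓘(ℝ, EG) ∞ unit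
  contMDiff_inv : ContMDiff 𝓘(ℝ, EG) 𝓘(ℝ, EG) ∞ inv
  contMDiffOn_mul : ContMDiffOn (𝓘(ℝ, EG).prod 𝓘(ℝ, EG)) 𝓘(ℝ, EG) ∞
    (fun p : G × G => mul p.1 p.2) {p | src p.1 = tgt p.2}
  src_unit : ∀ x, src (unit x) = x
  tgt_unit : ∀ x, tgt (unit x) = x
  src_mul : ∀ g h, src g = tgt h → src (mul g h) = src h
  tgt_mul : ∀ g h, src g = tgt h → tgt (mul g h) = tgt g
  mul_assoc : ∀ g h k, src g = tgt h → src h = tgt k → mul (mul g h) k = mul g (mul h k)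
  unit_mul : ∀ g, mul (unit (tgt g)) g = g
  mul_unit : ∀ g, mul g (unit (src g)) = g
  src_inv : ∀ g, src (inv g) = tgt g
  tgt_inv : ∀ g, tgt (inv g) = src g
  mul_inv : ∀ g, mul g (inv g) = unit (tgt g)
  inv_mul : ∀ g, mul (inv g) g = unit (src g)

/-- The derivative `V f` of a function `f` along a vector field `V`. -/
def vfDeriv {EG : Type*} [NormedAddCommGroup EG] [NormedSpace ℝ EG]
    {G : Type*} [TopologicalSpace G] [ChartedSpace EG G]
    (V : ∀ g : G, TangentSpace 𝓘(ℝ, EG) g) (f : G → ℝ) : G → ℝ :=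
  fun g => mfderiv 𝓘(ℝ, EG) 𝓘(ℝ, ℝ) f g (V g)

/-- The Hessian of `F` at `p`, computed in the preferred chart at `p` (the chart through which
Mathlib identifies `TangentSpace 𝓘(ℝ, EG) p` with the model space).  It is only used at critical
points, where it does not depend on the chart. -/
def hessAt {EG : Type*} [NormedAddCommGroup EG] [NormedSpace ℝ EG]
    {G : Type*} [TopologicalSpace G] [ChartedSpace EG G] (F : G → ℝ) (p : G) :
    TangentSpace 𝓘(ℝ, EG) p →ₗ[ℝ] TangentSpace 𝓘(ℝ, EG) p →ₗ[ℝ] ℝ :=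
  show EG →ₗ[ℝ] EG →ₗ[ℝ] ℝ from
    LinearMap.mk₂ ℝ
      (fun v w => fderiv ℝ (fderiv ℝ (F ∘ (extChartAt 𝓘(ℝ, EG) p).symm))
        (extChartAt 𝓘(ℝ, EG) p p) v w)
      (by simp) (by simp) (by simp) (by simp)

section Calculus

variable {EG : Type*} [NormedAddCommGroup EG] [NormedSpace ℝ EG]
  {G : Type*} [TopologicalSpace G] [ChartedSpace EG G] [IsManifold 𝓘(ℝ, EG) ∞ G]

theorem contDiffAt_chart {F : G → ℝ} (hF : ContMDiff 𝓘(ℝ, EG) 𝓘(ℝ, ℝ) ∞ F) (p : G) {y : EG}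
    (hy : y ∈ (extChartAt 𝓘(ℝ, EG) p).target) :
    ContDiffAt ℝ ∞ (F ∘ (extChartAt 𝓘(ℝ, EG) p).symm) y := by
  rw [← contMDiffAt_iff_contDiffAt]
  have h := (contMDiffOn_extChartAt_symm (I := 𝓘(ℝ, EG)) (n := ∞) p).contMDiffAt
    ((isOpen_extChartAt_target (I := 𝓘(ℝ, EG)) p).mem_nhds hy)
  exact (hF _).comp y h

theorem hessAt_symm {F : G → ℝ} (hF : ContMDiff 𝓘(ℝ, EG) 𝓘(ℝ, ℝ) ∞ F) (p : G)
    (v w : TangentSpace 𝓘(ℝ, EG) p) : hessAt F p v w = hessAt F p w v := by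
  have h := contDiffAt_chart hF p (mem_extChartAt_target p)
  exact (h.isSymmSndFDerivAt (by simp only [minSmoothness_of_isRCLikeNormedField]; exact WithTop.coe_le_coe.2 le_top)) v w

theorem vfDeriv_chart {f : G → ℝ} (p : G) (W : ∀ g : G, TangentSpace 𝓘(ℝ, EG) g) {g : G}
    (hg : g ∈ (chartAt EG p).source)
    (hf : DifferentiableAt ℝ (f ∘ (extChartAt 𝓘(ℝ, EG) p).symm) (extChartAt 𝓘(ℝ, EG) p g)) :
    vfDeriv W f g = fderiv ℝ (f ∘ (extChartAt 𝓘(ℝ, EG) p).symm) (extChartAt 𝓘(ℝ, EG) p g)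
      (mfderiv 𝓘(ℝ, EG) 𝓘(ℝ, EG) (extChartAt 𝓘(ℝ, EG) p) g (W g)) := by
  have hgs : g ∈ (extChartAt 𝓘(ℝ, EG) p).source := by simpa using hg
  have hev : f =ᶠ[𝓝 g]
      (f ∘ (extChartAt 𝓘(ℝ, EG) p).symm) ∘ (extChartAt 𝓘(ℝ, EG) p) := by
    filter_upwards [(isOpen_extChartAt_source (I := 𝓘(ℝ, EG)) p).mem_nhds hgs] with q hq
    simp only [Function.comp_apply, (extChartAt 𝓘(ℝ, EG) p).left_inv hq]
  have h2 : MDifferentiableAt 𝓘(ℝ, EG) 𝓘(ℝ, EG) (extChartAt 𝓘(ℝ, EG) p) g := by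
    have : IsManifold 𝓘(ℝ, EG) 1 G := IsManifold.of_le (n := ∞) (by simp)
    exact mdifferentiableAt_extChartAt hg
  unfold vfDeriv
  rw [hev.mfderiv_eq, mfderiv_comp g hf.mdifferentiableAt h2, mfderiv_eq_fderiv]
  rfl

/-- At a critical point of `F` the second derivative `V W F` only depends on the values of the
vector fields there, and is the Hessian. -/
theorem vfDeriv_vfDeriv_eq_hessAt {F : G → ℝ} (hF : ContMDiff 𝓘(ℝ, EG) 𝓘(ℝ, ℝ) ∞ F) {p : G}
    (hp : mfderiv 𝓘(ℝ, EG) 𝓘(ℝ, ℝ) F p = 0)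
    (V W : ∀ g : G, TangentSpace 𝓘(ℝ, EG) g)
    (hW : MDifferentiableAt 𝓘(ℝ, EG) 𝓘(ℝ, EG).tangent
      (fun g => (⟨g, W g⟩ : TangentBundle 𝓘(ℝ, EG) G)) p) :
    vfDeriv V (vfDeriv W F) p = hessAt F p (V p) (W p) := by
  have : IsManifold 𝓘(ℝ, EG) 1 G := IsManifold.of_le (n := ∞) (by simp)
  set φ := extChartAt 𝓘(ℝ, EG) p with hφ
  let Ft : EG → ℝ := F ∘ φ.symm
  let B : G → EG := fun g => mfderiv 𝓘(ℝ, EG) 𝓘(ℝ, EG) φ g (W g)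
  have hpt : φ p ∈ φ.target := mem_extChartAt_target p
  have hFt : ∀ y ∈ φ.target, ContDiffAt ℝ ∞ Ft y := fun y hy => contDiffAt_chart hF p hy
  have hB : MDifferentiableAt 𝓘(ℝ, EG) 𝓘(ℝ, EG) B p := by
    have h := (mdifferentiableAt_section _ W).1 hW
    refine h.congr_of_eventuallyEq ?_
    filter_upwards [(chartAt EG p).open_source.mem_nhds (mem_chart_source EG p)] with q hq
    have h' := TangentBundle.continuousLinearMapAt_trivializationAt (I := 𝓘(ℝ, EG)) hq
    have h'' := DFunLike.congr_fun h' (W q)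
    refine h''.symm.trans ?_
    rw [Bundle.Trivialization.continuousLinearMapAt_apply]
    rw [Bundle.Trivialization.linearMapAt_apply, if_pos]
    simpa using hq
  have hBφ : DifferentiableAt ℝ (B ∘ φ.symm) (φ p) := by
    rw [← mdifferentiableAt_iff_differentiableAt]
    have h1 : MDifferentiableAt 𝓘(ℝ, EG) 𝓘(ℝ, EG) φ.symm (φ p) :=
      ((contMDiffOn_extChartAt_symm (I := 𝓘(ℝ, EG)) (n := 1) p).contMDiffAt
        ((isOpen_extChartAt_target (I := 𝓘(ℝ, EG)) p).mem_nhds hpt)).mdifferentiableAt (by simp)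
    have h2 : φ.symm (φ p) = p := extChartAt_to_inv p
    exact MDifferentiableAt.comp (φ p) (by rw [h2]; exact hB) h1
  have hA : DifferentiableAt ℝ (fderiv ℝ Ft) (φ p) :=
    ((hFt _ hpt).fderiv_right (m := 1) (by exact WithTop.coe_le_coe.2 le_top)).differentiableAt (by simp)
  have hself : ∀ v, mfderiv 𝓘(ℝ, EG) 𝓘(ℝ, EG) φ p v = v := fun v => by
    rw [hφ, mfderiv_extChartAt_self]; rfl
  have hA0 : fderiv ℝ Ft (φ p) = 0 := by
    ext v
    have h := vfDeriv_chart (f := F) p (fun _ => v) (mem_chart_source EG p)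
      ((hFt _ hpt).differentiableAt (by simp))
    rw [← hφ, hself v] at h
    refine h.symm.trans ?_
    unfold vfDeriv
    rw [hp]
    rfl
  have hev : vfDeriv W F ∘ φ.symm =ᶠ[𝓝 (φ p)] fun y => fderiv ℝ Ft y ((B ∘ φ.symm) y) := by
    filter_upwards [(isOpen_extChartAt_target (I := 𝓘(ℝ, EG)) p).mem_nhds hpt] with y hy
    have hy' : φ.symm y ∈ (chartAt EG p).source := by
      have := φ.map_target hy
      rwa [hφ, extChartAt_source] at this
    have h4 : φ (φ.symm y) = y := φ.right_inv hy
    have h := vfDeriv_chart (f := F) p W hy'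
      (by rw [← hφ, h4]; exact (hFt _ hy).differentiableAt (by simp))
    rw [← hφ, h4] at h
    exact h
  have hder := (hA.hasFDerivAt.clm_apply hBφ.hasFDerivAt).congr_of_eventuallyEq hev
  have h := vfDeriv_chart (f := vfDeriv W F) p V (mem_chart_source EG p) hder.differentiableAt
  rw [← hφ, hder.fderiv] at h
  rw [h, hA0]
  have h2 : φ.symm (φ p) = p := extChartAt_to_inv p
  have hBp : (B ∘ φ.symm) (φ p) = W p := by
    change B (φ.symm (φ p)) = W p
    rw [h2]
    exact hself (W p)
  rw [hBp, hself (V p), ContinuousLinearMap.zero_comp, zero_add]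
  rfl

/-- If `F` is critical along a curve, or more generally along the image of a map `c`, then the
directions tangent to `c` are in the kernel of the Hessian. -/
theorem hessAt_mfderiv {EM : Type*} [NormedAddCommGroup EM] [NormedSpace ℝ EM]
    {M : Type*} [TopologicalSpace M] [ChartedSpace EM M]
    {F : G → ℝ} (hF : ContMDiff 𝓘(ℝ, EG) 𝓘(ℝ, ℝ) ∞ F) {c : M → G}
    (hcrit : ∀ x, mfderiv 𝓘(ℝ, EG) 𝓘(ℝ, ℝ) F (c x) = 0) {x : M}
    (hc : MDifferentiableAt 𝓘(ℝ, EM) 𝓘(ℝ, EG) c x)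
    (u : TangentSpace 𝓘(ℝ, EM) x) (w : TangentSpace 𝓘(ℝ, EG) (c x)) :
    hessAt F (c x) (mfderiv 𝓘(ℝ, EM) 𝓘(ℝ, EG) c x u) w = 0 := by
  have : IsManifold 𝓘(ℝ, EG) 1 G := IsManifold.of_le (n := ∞) (by simp)
  set φ := extChartAt 𝓘(ℝ, EG) (c x) with hφ
  let Ft : EG → ℝ := F ∘ φ.symm
  have hpt : φ (c x) ∈ φ.target := mem_extChartAt_target (c x)
  have hFt : ∀ y ∈ φ.target, ContDiffAt ℝ ∞ Ft y := fun y hy => contDiffAt_chart hF (c x) hy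
  have hA : DifferentiableAt ℝ (fderiv ℝ Ft) (φ (c x)) :=
    ((hFt _ hpt).fderiv_right (m := 1)
      (by exact WithTop.coe_le_coe.2 le_top)).differentiableAt (by simp)
  have hself : ∀ v, mfderiv 𝓘(ℝ, EG) 𝓘(ℝ, EG) φ (c x) v = v := fun v => by
    rw [hφ, mfderiv_extChartAt_self]; rfl
  have hzero : ∀ y ∈ φ.target, mfderiv 𝓘(ℝ, EG) 𝓘(ℝ, ℝ) F (φ.symm y) = 0 →
      fderiv ℝ Ft y = 0 := by
    intro y hy h0
    have h1 : MDifferentiableAt 𝓘(ℝ, EG) 𝓘(ℝ, EG) φ.symm y :=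
      ((contMDiffOn_extChartAt_symm (I := 𝓘(ℝ, EG)) (n := 1) (c x)).contMDiffAt
        ((isOpen_extChartAt_target (I := 𝓘(ℝ, EG)) (c x)).mem_nhds hy)).mdifferentiableAt (by simp)
    rw [← mfderiv_eq_fderiv]
    have h2 := mfderiv_comp (I := 𝓘(ℝ, EG)) (I' := 𝓘(ℝ, EG)) (I'' := 𝓘(ℝ, ℝ)) (g := F) y
      ((hF (φ.symm y)).mdifferentiableAt (by simp)) h1
    rw [h0] at h2
    exact h2.trans (ContinuousLinearMap.zero_comp _)
  have hφd : MDifferentiableAt 𝓘(ℝ, EG) 𝓘(ℝ, EG) φ (c x) :=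
    mdifferentiableAt_extChartAt (mem_chart_source EG (c x))
  have hcomp : MDifferentiableAt 𝓘(ℝ, EM) 𝓘(ℝ, EG) (φ ∘ c) x := hφd.comp x hc
  have hev : (fun z => fderiv ℝ Ft ((φ ∘ c) z)) =ᶠ[𝓝 x] fun _ => 0 := by
    have hsrc : ∀ᶠ z in 𝓝 x, c z ∈ φ.source := hc.continuousAt.eventually
      ((isOpen_extChartAt_source (I := 𝓘(ℝ, EG)) (c x)).mem_nhds (mem_extChartAt_source (c x)))
    filter_upwards [hsrc] with z hz
    exact hzero _ (φ.map_source hz) (by rw [Function.comp_apply, φ.left_inv hz]; exact hcrit z)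
  have h1 := hev.mfderiv_eq (I := 𝓘(ℝ, EM)) (I' := 𝓘(ℝ, EG →L[ℝ] ℝ))
  have h2 := mfderiv_comp (I := 𝓘(ℝ, EM)) (I' := 𝓘(ℝ, EG)) (I'' := 𝓘(ℝ, EG →L[ℝ] ℝ))
    (g := fderiv ℝ Ft) x hA.mdifferentiableAt hcomp
  have h3 := mfderiv_comp (I := 𝓘(ℝ, EM)) (I' := 𝓘(ℝ, EG)) (I'' := 𝓘(ℝ, EG)) (g := φ) x hφd hc
  have h4 : fderiv ℝ (fderiv ℝ Ft) (φ (c x)) (mfderiv 𝓘(ℝ, EM) 𝓘(ℝ, EG) (φ ∘ c) x u) = 0 := by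
    have h5 := h2.symm.trans (h1.trans mfderiv_const)
    rw [mfderiv_eq_fderiv] at h5
    exact DFunLike.congr_fun h5 u
  rw [h3] at h4
  have h6 : (mfderiv 𝓘(ℝ, EG) 𝓘(ℝ, EG) φ (c x)).comp (mfderiv 𝓘(ℝ, EM) 𝓘(ℝ, EG) c x) u
      = mfderiv 𝓘(ℝ, EM) 𝓘(ℝ, EG) c x u := hself _
  rw [h6] at h4
  exact DFunLike.congr_fun h4 w

end Calculus

namespace LieGroupoid

section Algebroid

variable {EM : Type*} [NormedAddCommGroup EM] [NormedSpace ℝ EM]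
  {EG : Type*} [NormedAddCommGroup EG] [NormedSpace ℝ EG]
  {M : Type*} [TopologicalSpace M] [ChartedSpace EM M]
  {G : Type*} [TopologicalSpace G] [ChartedSpace EG G]
  (𝒢 : LieGroupoid EM EG M G)

/-- The tangent space `T_x M` inside `T_{unit x} G`. -/
abbrev unitTangent (x : M) : Submodule ℝ (TangentSpace 𝓘(ℝ, EG) (𝒢.unit x)) :=
  LinearMap.range (mfderiv 𝓘(ℝ, EM) 𝓘(ℝ, EG) 𝒢.unit x).toLinearMap

/-- The fibre at `x` of the Lie algebroid `E = Lie(G)`, i.e. of the normal bundle `TG|_M / TM`. -/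
abbrev AlgFibre (x : M) : Type _ := TangentSpace 𝓘(ℝ, EG) (𝒢.unit x) ⧸ 𝒢.unitTangent x

/-- The differential of the target map at a unit. -/
def dTgt (x : M) : TangentSpace 𝓘(ℝ, EG) (𝒢.unit x) →ₗ[ℝ] TangentSpace 𝓘(ℝ, EM) x :=
  (mfderiv 𝓘(ℝ, EG) 𝓘(ℝ, EM) 𝒢.tgt (𝒢.unit x)).toLinearMap

/-- The differential of the source map at a unit. -/
def dSrc (x : M) : TangentSpace 𝓘(ℝ, EG) (𝒢.unit x) →ₗ[ℝ] TangentSpace 𝓘(ℝ, EM) x :=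
  (mfderiv 𝓘(ℝ, EG) 𝓘(ℝ, EM) 𝒢.src (𝒢.unit x)).toLinearMap

/-- The differential of the unit embedding. -/
def dUnit (x : M) : TangentSpace 𝓘(ℝ, EM) x →ₗ[ℝ] TangentSpace 𝓘(ℝ, EG) (𝒢.unit x) :=
  (mfderiv 𝓘(ℝ, EM) 𝓘(ℝ, EG) 𝒢.unit x).toLinearMap

theorem mfderiv_of_section {r : G → M} (hr : ContMDiff 𝓘(ℝ, EG) 𝓘(ℝ, EM) ∞ r)
    (h : ∀ x, r (𝒢.unit x) = x) (x : M) (u : TangentSpace 𝓘(ℝ, EM) x) :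
    (mfderiv 𝓘(ℝ, EG) 𝓘(ℝ, EM) r (𝒢.unit x)) (mfderiv 𝓘(ℝ, EM) 𝓘(ℝ, EG) 𝒢.unit x u) = u := by
  have h1 := mfderiv_comp (I := 𝓘(ℝ, EM)) (I' := 𝓘(ℝ, EG)) (I'' := 𝓘(ℝ, EM)) (g := r) x
    ((hr _).mdifferentiableAt (by simp)) ((𝒢.contMDiff_unit x).mdifferentiableAt (by simp))
  have h2 : r ∘ 𝒢.unit = id := funext h
  rw [h2, mfderiv_id] at h1
  exact (DFunLike.congr_fun h1 u).symm

theorem dTgt_dUnit (x : M) (u : TangentSpace 𝓘(ℝ, EM) x) : 𝒢.dTgt x (𝒢.dUnit x u) = u :=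
  𝒢.mfderiv_of_section 𝒢.tgt_submersion.contMDiff 𝒢.tgt_unit x u

theorem dSrc_dUnit (x : M) (u : TangentSpace 𝓘(ℝ, EM) x) : 𝒢.dSrc x (𝒢.dUnit x u) = u :=
  𝒢.mfderiv_of_section 𝒢.src_submersion.contMDiff 𝒢.src_unit x u

/-- The representative of a normal vector that is tangent to the target fibre. -/
def leftLift (x : M) : 𝒢.AlgFibre x →ₗ[ℝ] TangentSpace 𝓘(ℝ, EG) (𝒢.unit x) :=
  (𝒢.unitTangent x).liftQ (LinearMap.id - 𝒢.dUnit x ∘ₗ 𝒢.dTgt x) (by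
    rintro _ ⟨u, rfl⟩
    change 𝒢.dUnit x u - 𝒢.dUnit x (𝒢.dTgt x (𝒢.dUnit x u)) = 0
    rw [dTgt_dUnit, sub_self])

/-- The representative of a normal vector that is tangent to the source fibre. -/
def rightLift (x : M) : 𝒢.AlgFibre x →ₗ[ℝ] TangentSpace 𝓘(ℝ, EG) (𝒢.unit x) :=
  (𝒢.unitTangent x).liftQ (LinearMap.id - 𝒢.dUnit x ∘ₗ 𝒢.dSrc x) (by
    rintro _ ⟨u, rfl⟩
    change 𝒢.dUnit x u - 𝒢.dUnit x (𝒢.dSrc x (𝒢.dUnit x u)) = 0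
    rw [dSrc_dUnit, sub_self])

theorem leftLift_mk (x : M) (v : TangentSpace 𝓘(ℝ, EG) (𝒢.unit x)) :
    𝒢.leftLift x ((𝒢.unitTangent x).mkQ v) = v - 𝒢.dUnit x (𝒢.dTgt x v) := rfl

theorem rightLift_mk (x : M) (v : TangentSpace 𝓘(ℝ, EG) (𝒢.unit x)) :
    𝒢.rightLift x ((𝒢.unitTangent x).mkQ v) = v - 𝒢.dUnit x (𝒢.dSrc x v) := rfl

theorem dTgt_leftLift (x : M) (e : 𝒢.AlgFibre x) : 𝒢.dTgt x (𝒢.leftLift x e) = 0 := by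
  obtain ⟨v, rfl⟩ := (𝒢.unitTangent x).mkQ_surjective e
  rw [leftLift_mk, map_sub, dTgt_dUnit, sub_self]

theorem dSrc_rightLift (x : M) (e : 𝒢.AlgFibre x) : 𝒢.dSrc x (𝒢.rightLift x e) = 0 := by
  obtain ⟨v, rfl⟩ := (𝒢.unitTangent x).mkQ_surjective e
  rw [rightLift_mk, map_sub, dSrc_dUnit, sub_self]

theorem mk_leftLift (x : M) (e : 𝒢.AlgFibre x) :
    (𝒢.unitTangent x).mkQ (𝒢.leftLift x e) = e := by
  obtain ⟨v, rfl⟩ := (𝒢.unitTangent x).mkQ_surjective e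
  have h : (𝒢.unitTangent x).mkQ (𝒢.dUnit x (𝒢.dTgt x v)) = 0 := by
    rw [Submodule.mkQ_apply, Submodule.Quotient.mk_eq_zero]
    exact ⟨𝒢.dTgt x v, rfl⟩
  rw [leftLift_mk, map_sub, h, sub_zero]

theorem mk_rightLift (x : M) (e : 𝒢.AlgFibre x) :
    (𝒢.unitTangent x).mkQ (𝒢.rightLift x e) = e := by
  obtain ⟨v, rfl⟩ := (𝒢.unitTangent x).mkQ_surjective e
  have h : (𝒢.unitTangent x).mkQ (𝒢.dUnit x (𝒢.dSrc x v)) = 0 := by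
    rw [Submodule.mkQ_apply, Submodule.Quotient.mk_eq_zero]
    exact ⟨𝒢.dSrc x v, rfl⟩
  rw [rightLift_mk, map_sub, h, sub_zero]

/-- The left-invariant vector field `X^L`: its value at `g` is the image, under the differential of
left translation `L_g : tgt⁻¹(src g) → tgt⁻¹(tgt g)`, of the representative of `X (src g)` tangent
to the target fibre.  The derivative within the fibre is determined on vectors tangent to it, so
that the choice made by `mfderivWithin` is immaterial here. -/
def leftField (X : ∀ x, 𝒢.AlgFibre x) (g : G) : TangentSpace 𝓘(ℝ, EG) g :=
  mfderivWithin 𝓘(ℝ, EG) 𝓘(ℝ, EG) (fun h => 𝒢.mul g h) {h | 𝒢.tgt h = 𝒢.src g}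
    (𝒢.unit (𝒢.src g)) (𝒢.leftLift (𝒢.src g) (X (𝒢.src g)))

/-- The right-invariant vector field `X^R`: its value at `g` is the image, under the differential
of right translation `R_g : src⁻¹(tgt g) → src⁻¹(src g)`, of the representative of `X (tgt g)`
tangent to the source fibre. -/
def rightField (X : ∀ x, 𝒢.AlgFibre x) (g : G) : TangentSpace 𝓘(ℝ, EG) g :=
  mfderivWithin 𝓘(ℝ, EG) 𝓘(ℝ, EG) (fun h => 𝒢.mul h g) {h | 𝒢.src h = 𝒢.tgt g}
    (𝒢.unit (𝒢.tgt g)) (𝒢.rightLift (𝒢.tgt g) (X (𝒢.tgt g)))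

variable [IsManifold 𝓘(ℝ, EG) ∞ G]

/-- `X` is a smooth section of `E = TG|_M / TM` over `U`: locally it lifts to a smooth section of
`TG|_M`. -/
def IsSmoothSectionOn (U : Set M) (X : ∀ x, 𝒢.AlgFibre x) : Prop :=
  ∀ x₀ ∈ U, ∃ U' : Set M, IsOpen U' ∧ x₀ ∈ U' ∧
    ∃ v : ∀ x, TangentSpace 𝓘(ℝ, EG) (𝒢.unit x),
      ContMDiffOn 𝓘(ℝ, EM) 𝓘(ℝ, EG).tangent ∞
        (fun x => (⟨𝒢.unit x, v x⟩ : TangentBundle 𝓘(ℝ, EG) G)) U' ∧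
      ∀ x ∈ U', X x = (𝒢.unitTangent x).mkQ (v x)

/-- Smooth global sections of the Lie algebroid. -/
def IsSmoothSection (X : ∀ x, 𝒢.AlgFibre x) : Prop := 𝒢.IsSmoothSectionOn Set.univ X

/-- A contrast function: a smooth function on `G` that vanishes, together with its differential, at
all units. -/
structure ContrastFunction where
  toFun : G → ℝ
  contMDiff : ContMDiff 𝓘(ℝ, EG) 𝓘(ℝ, ℝ) ∞ toFun
  apply_unit : ∀ x, toFun (𝒢.unit x) = 0
  mfderiv_unit : ∀ x, mfderiv 𝓘(ℝ, EG) 𝓘(ℝ, ℝ) toFun (𝒢.unit x) = 0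

variable {𝒢}

namespace ContrastFunction

variable (F : 𝒢.ContrastFunction)

/-- The function `F^* = F ∘ inv`. -/
def dual : G → ℝ := fun g => F.toFun (𝒢.inv g)

/-- The symmetric form `g^F` on the fibre `E_x`. -/
def form (x : M) : 𝒢.AlgFibre x →ₗ[ℝ] 𝒢.AlgFibre x →ₗ[ℝ] ℝ :=
  (hessAt F.toFun (𝒢.unit x)).compl₁₂ (𝒢.leftLift x) (𝒢.leftLift x)

/-- The kernel `K^F` of `g^F` at `x`. -/
abbrev ker (x : M) : Submodule ℝ (𝒢.AlgFibre x) := LinearMap.ker (F.form x)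

/-- The fibre at `x` of the quotient bundle `L^F = E / K^F`. -/
abbrev QuotFibre (x : M) : Type _ := 𝒢.AlgFibre x ⧸ F.ker x

/-- `F` is regular: the bundle morphism `g^F : E → E^*` has constant rank. -/
def IsRegular : Prop := ∃ r : ℕ, ∀ x, Module.finrank ℝ (LinearMap.range (F.form x)) = r

/-- `W` is a smooth section of `L^F = E / K^F`: locally it lifts to a smooth section of `E`. -/
def IsSmoothQuotSection (W : ∀ x, F.QuotFibre x) : Prop :=
  ∀ x₀, ∃ U : Set M, IsOpen U ∧ x₀ ∈ U ∧
    ∃ X : ∀ x, 𝒢.AlgFibre x, 𝒢.IsSmoothSectionOn U X ∧ ∀ x ∈ U, W x = (F.ker x).mkQ (X x)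

/-- The Koszul conditions on a regular contrast function: `X^L Y^L Z^R F` and `X^L Y^L Z^R F^*`
vanish at the units for all sections `X`, `Y` of `E` and `Z` of `K^F`. -/
structure IsKoszul : Prop where
  regular : F.IsRegular
  left : ∀ X Y Z : ∀ x, 𝒢.AlgFibre x, 𝒢.IsSmoothSection X → 𝒢.IsSmoothSection Y →
    𝒢.IsSmoothSection Z → (∀ x, Z x ∈ F.ker x) → ∀ x,
    vfDeriv (𝒢.leftField X) (vfDeriv (𝒢.leftField Y) (vfDeriv (𝒢.rightField Z) F.toFun))
      (𝒢.unit x) = 0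
  right : ∀ X Y Z : ∀ x, 𝒢.AlgFibre x, 𝒢.IsSmoothSection X → 𝒢.IsSmoothSection Y →
    𝒢.IsSmoothSection Z → (∀ x, Z x ∈ F.ker x) → ∀ x,
    vfDeriv (𝒢.leftField X) (vfDeriv (𝒢.leftField Y) (vfDeriv (𝒢.rightField Z) F.dual))
      (𝒢.unit x) = 0

theorem form_symm (x : M) (a b : 𝒢.AlgFibre x) : F.form x a b = F.form x b a :=
  hessAt_symm F.contMDiff _ _ _

theorem form_mk (x : M) (v w : TangentSpace 𝓘(ℝ, EG) (𝒢.unit x)) :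
    F.form x ((𝒢.unitTangent x).mkQ v) ((𝒢.unitTangent x).mkQ w)
      = hessAt F.toFun (𝒢.unit x) v w := by
  have hz : ∀ (u : TangentSpace 𝓘(ℝ, EM) x) (z : TangentSpace 𝓘(ℝ, EG) (𝒢.unit x)),
      hessAt F.toFun (𝒢.unit x) (𝒢.dUnit x u) z = 0 := fun u z =>
    hessAt_mfderiv F.contMDiff F.mfderiv_unit
      ((𝒢.contMDiff_unit x).mdifferentiableAt (by simp)) u z
  change hessAt F.toFun (𝒢.unit x) (𝒢.leftLift x _) (𝒢.leftLift x _) = _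
  rw [leftLift_mk, leftLift_mk, LinearMap.map_sub₂, hz, sub_zero, map_sub,
    hessAt_symm F.contMDiff _ v (𝒢.dUnit x _), hz, sub_zero]

/-- `g^F(X, Y) = X̃ Ỹ F|_M` for all vector fields `X̃`, `Ỹ` on `G` representing `X`, `Y` along the
units. -/
theorem vfDeriv_vfDeriv_eq_form (V W : ∀ g : G, TangentSpace 𝓘(ℝ, EG) g) (x : M)
    (hW : MDifferentiableAt 𝓘(ℝ, EG) 𝓘(ℝ, EG).tangent
      (fun g => (⟨g, W g⟩ : TangentBundle 𝓘(ℝ, EG) G)) (𝒢.unit x)) :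
    vfDeriv V (vfDeriv W F.toFun) (𝒢.unit x)
      = F.form x ((𝒢.unitTangent x).mkQ (V (𝒢.unit x))) ((𝒢.unitTangent x).mkQ (W (𝒢.unit x))) := by
  rw [form_mk]
  exact vfDeriv_vfDeriv_eq_hessAt F.contMDiff (F.mfderiv_unit x) V W hW

/-- The transversal metric `g^{[F]}` induced by `g^F` on `L^F`. -/
def transMetric (x : M) : F.QuotFibre x →ₗ[ℝ] F.QuotFibre x →ₗ[ℝ] ℝ :=
  ((F.ker x).liftQ ((F.ker x).liftQ (F.form x) le_rfl).flip (by
    intro a ha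
    refine LinearMap.mem_ker.2 (LinearMap.ext fun c => ?_)
    obtain ⟨b, rfl⟩ := (F.ker x).mkQ_surjective c
    change F.form x b a = 0
    rw [F.form_symm, LinearMap.mem_ker.1 ha, LinearMap.zero_apply])).flip

theorem transMetric_mk (x : M) (a b : 𝒢.AlgFibre x) :
    F.transMetric x ((F.ker x).mkQ a) ((F.ker x).mkQ b) = F.form x a b := rfl

end ContrastFunction

end Algebroid

end LieGroupoid

end

/-! Fix `X` and `Y`, and let `H` be `F` or `F ∘ inv`. The whole matter is that `X^L Y^L Z^R H` along
the units is tensorial in `Z`. Indeed `Z^R H` at `g` depends only on the value of `Z` at the target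
of `g`, and left-invariant fields differentiate along the target fibres, where the target is
constant (`thirdDeriv_congr`). So at each `x` there is a linear form `T x` on `E_x`
(`exists_thirdDeriv_linear`).

The Koszul condition says that `T x` kills values of global sections of `K^F`. Constant rank makes
every vector of `K^F` such a value (`exists_ker_section`), so `T x` descends to `L^F`, where the
metric is non-degenerate. This gives existence and uniqueness at each point.

For smoothness of the representing section, vectors at `x₀` with non-zero Gram determinant are
extended to sections `e i`; near `x₀` these form a frame of `L^F`, again by constant rank
(`exists_quotFrame`), and Cramer's rule gives smooth coefficients.

All this needs `X^L` and `Z^R` to be smooth, although their definition differentiates within a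
fibre. A smooth family of local projections onto the target fibres (`exists_fibreProj`) turns `X^L`
into a derivative of a smooth map on an open subset of `G × G`; the opposite groupoid handles `Z^R`.
-/

namespace LieGroupoid

/-! ### Local projections onto the target fibres -/

section Fields

variable {EM : Type*} [NormedAddCommGroup EM] [NormedSpace ℝ EM]
  {EG : Type*} [NormedAddCommGroup EG] [NormedSpace ℝ EG]
  {M : Type*} [TopologicalSpace M] [ChartedSpace EM M]
  {G : Type*} [TopologicalSpace G] [ChartedSpace EG G]
  (𝒢 : LieGroupoid EM EG M G)

/-- The opposite groupoid. Its left-invariant fields are the right-invariant fields of `𝒢`. -/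
def op : LieGroupoid EM EG M G where
  unit := 𝒢.unit
  src := 𝒢.tgt
  tgt := 𝒢.src
  mul g h := 𝒢.mul h g
  inv := 𝒢.inv
  src_surjective := 𝒢.tgt_surjective
  tgt_surjective := 𝒢.src_surjective
  src_submersion := 𝒢.tgt_submersion
  tgt_submersion := 𝒢.src_submersion
  contMDiff_unit := 𝒢.contMDiff_unit
  contMDiff_inv := 𝒢.contMDiff_inv
  contMDiffOn_mul := 𝒢.contMDiffOn_mul.comp (contMDiff_snd.prodMk contMDiff_fst).contMDiffOn
    fun _ hp => hp.symm
  src_unit := 𝒢.tgt_unit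
  tgt_unit := 𝒢.src_unit
  src_mul g h hgh := 𝒢.tgt_mul h g hgh.symm
  tgt_mul g h hgh := 𝒢.src_mul h g hgh.symm
  mul_assoc g h k hgh hhk := (𝒢.mul_assoc k h g hhk.symm hgh.symm).symm
  unit_mul := 𝒢.mul_unit
  mul_unit := 𝒢.unit_mul
  src_inv := 𝒢.tgt_inv
  tgt_inv := 𝒢.src_inv
  mul_inv := 𝒢.inv_mul
  inv_mul := 𝒢.mul_inv

/-- Near a unit there is a smooth family of local projections of `G` onto the target fibres, which
collapses the units of `G` onto the unit in the fibre. -/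
theorem exists_fibreProj (x₀ : M) :
    ∃ (U : Set (M × G)) (π : M × G → G), IsOpen U ∧ (x₀, 𝒢.unit x₀) ∈ U ∧
      ContMDiffOn (𝓘(ℝ, EM).prod 𝓘(ℝ, EG)) 𝓘(ℝ, EG) ∞ π U ∧
      (∀ p ∈ U, 𝒢.tgt (π p) = p.1) ∧
      (∀ h, (𝒢.tgt h, h) ∈ U → π (𝒢.tgt h, h) = h) ∧
      ∀ x y, (x, 𝒢.unit y) ∈ U → π (x, 𝒢.unit y) = 𝒢.unit x := by
  obtain ⟨C, _, _, hsub⟩ := 𝒢.tgt_submersion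
  have hs := hsub (𝒢.unit x₀)
  set φ := hs.domChart
  set ψ := hs.codChart
  set e := hs.equiv
  have hφψ : ∀ h ∈ φ.source, 𝒢.tgt h ∈ ψ.source := fun h hh => hs.source_subset_preimage_source hh
  have hwr : ∀ z ∈ φ.target, ψ (𝒢.tgt (φ.symm z)) = (e z).1 := fun z hz => by
    have hz' : z ∈ (φ.extend 𝓘(ℝ, EG)).target := by simpa [OpenPartialHomeomorph.extend] using hz
    simpa [OpenPartialHomeomorph.extend] using hs.writtenInCharts hz'
  have hwr' : ∀ h ∈ φ.source, ψ (𝒢.tgt h) = (e (φ h)).1 := fun h hh => by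
    rw [← hwr _ (φ.map_source hh), φ.left_inv hh]
  have htgt : ContMDiff 𝓘(ℝ, EG) 𝓘(ℝ, EM) ∞ 𝒢.tgt := 𝒢.tgt_submersion.contMDiff
  let q : G → C := fun h => (e (φ h)).2
  -- In adapted charts the target map is the projection to the first factor, so the first coordinate
  -- is replaced by that of `p.1`. The translation in the second factor carries units to units, and
  -- it cancels when `p.1` is the target of `p.2`.
  let c : M × G → EG := fun p =>
    e.symm (ψ p.1, q p.2 - q (𝒢.unit (𝒢.tgt p.2)) + q (𝒢.unit p.1))
  let U₁ : Set (M × G) := {p | p.1 ∈ ψ.source ∧ 𝒢.unit p.1 ∈ φ.source ∧ p.2 ∈ φ.source ∧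
    𝒢.unit (𝒢.tgt p.2) ∈ φ.source}
  have hunit : Continuous 𝒢.unit := 𝒢.contMDiff_unit.continuous
  have hU₁ : IsOpen U₁ := by
    have h1 := ψ.open_source.preimage (continuous_fst (X := M) (Y := G))
    have h2 := φ.open_source.preimage (hunit.comp (continuous_fst (X := M) (Y := G)))
    have h3 := φ.open_source.preimage (continuous_snd (X := M) (Y := G))
    have h4 := φ.open_source.preimage
      ((hunit.comp htgt.continuous).comp (continuous_snd (X := M) (Y := G)))
    exact h1.inter (h2.inter (h3.inter h4))
  have hq : ContMDiffOn 𝓘(ℝ, EG) 𝓘(ℝ, C) ∞ q φ.source :=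
    ((contDiff_snd.comp e.contDiff).contMDiff).comp_contMDiffOn
      (contMDiffOn_of_mem_maximalAtlas hs.domChart_mem_maximalAtlas)
  have hc : ContMDiffOn (𝓘(ℝ, EM).prod 𝓘(ℝ, EG)) 𝓘(ℝ, EG) ∞ c U₁ := by
    have h1 : ContMDiffOn (𝓘(ℝ, EM).prod 𝓘(ℝ, EG)) 𝓘(ℝ, EM) ∞ (fun p : M × G => ψ p.1) U₁ :=
      (contMDiffOn_of_mem_maximalAtlas hs.codChart_mem_maximalAtlas).comp contMDiff_fst.contMDiffOn
        fun p hp => hp.1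
    have h2 : ContMDiffOn (𝓘(ℝ, EM).prod 𝓘(ℝ, EG)) 𝓘(ℝ, C) ∞ (fun p : M × G => q p.2) U₁ :=
      hq.comp contMDiff_snd.contMDiffOn fun p hp => hp.2.2.1
    have h3 : ContMDiffOn (𝓘(ℝ, EM).prod 𝓘(ℝ, EG)) 𝓘(ℝ, C) ∞
        (fun p : M × G => q (𝒢.unit (𝒢.tgt p.2))) U₁ :=
      hq.comp (𝒢.contMDiff_unit.comp (htgt.comp contMDiff_snd)).contMDiffOn fun p hp => hp.2.2.2
    have h4 : ContMDiffOn (𝓘(ℝ, EM).prod 𝓘(ℝ, EG)) 𝓘(ℝ, C) ∞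
        (fun p : M × G => q (𝒢.unit p.1)) U₁ :=
      hq.comp (𝒢.contMDiff_unit.comp contMDiff_fst).contMDiffOn fun p hp => hp.2.1
    exact e.symm.contDiff.contMDiff.comp_contMDiffOn (h1.prodMk_space ((h2.sub h3).add h4))
  have hcz : ∀ x, x ∈ ψ.source → 𝒢.unit x ∈ φ.source → ∀ z, z = q (𝒢.unit x) →
      e.symm (ψ x, z) = φ (𝒢.unit x) := by
    rintro x hx hux z rfl
    rw [ContinuousLinearEquiv.symm_apply_eq]
    refine Prod.ext ?_ rfl
    have := hwr' _ hux
    rwa [𝒢.tgt_unit] at this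
  refine ⟨U₁ ∩ c ⁻¹' φ.target, fun p => φ.symm (c p), hc.continuousOn.isOpen_inter_preimage hU₁
    φ.open_target, ⟨⟨?_, ?_, ?_, ?_⟩, ?_⟩, ?_, ?_, ?_, ?_⟩
  · simpa [𝒢.tgt_unit] using hφψ _ hs.mem_domChart_source
  · exact hs.mem_domChart_source
  · exact hs.mem_domChart_source
  · simpa [𝒢.tgt_unit] using hs.mem_domChart_source
  · have := hcz x₀ (by simpa [𝒢.tgt_unit] using hφψ _ hs.mem_domChart_source)
      hs.mem_domChart_source _ (show q (𝒢.unit x₀) - q (𝒢.unit (𝒢.tgt (𝒢.unit x₀)))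
        + q (𝒢.unit x₀) = _ by rw [𝒢.tgt_unit]; abel)
    change c (x₀, 𝒢.unit x₀) ∈ φ.target
    rw [show c (x₀, 𝒢.unit x₀) = _ from this]
    exact φ.map_source hs.mem_domChart_source
  · exact (contMDiffOn_symm_of_mem_maximalAtlas hs.domChart_mem_maximalAtlas).comp
      (hc.mono Set.inter_subset_left) fun p hp => hp.2
  · rintro p ⟨hp, hcp⟩
    refine ψ.injOn (hφψ _ (φ.map_target hcp)) hp.1 ?_
    rw [hwr _ hcp]
    simp [c]
  · rintro h ⟨hp, hcp⟩
    have : c (𝒢.tgt h, h) = φ h := by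
      simp only [c]
      rw [ContinuousLinearEquiv.symm_apply_eq]
      refine Prod.ext (hwr' h hp.2.2.1) ?_
      change q h - _ + _ = q h
      abel
    simp only [this]
    exact φ.left_inv hp.2.2.1
  · rintro x y ⟨hp, hcp⟩
    have := hcz x hp.1 hp.2.1 _ (show q (𝒢.unit y) - q (𝒢.unit (𝒢.tgt (𝒢.unit y)))
        + q (𝒢.unit x) = _ by rw [𝒢.tgt_unit]; abel)
    simp only
    rw [show c (x, 𝒢.unit y) = _ from this]
    exact φ.left_inv hp.2.1

/-- The tangent space at a unit splits as `TM` plus the kernel of `dTgt`. The slice `π (x, ·)` is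
constant on units, so its derivative kills `TM`. Differentiating `π (tgt h, h) = h` along a vector
killed by `dTgt` leaves only the second partial derivative, which therefore fixes that vector. -/
theorem mfderiv_fibreProj {U : Set (M × G)} {π : M × G → G} (hU : IsOpen U)
    (hπ : ContMDiffOn (𝓘(ℝ, EM).prod 𝓘(ℝ, EG)) 𝓘(ℝ, EG) ∞ π U)
    (hπid : ∀ h, (𝒢.tgt h, h) ∈ U → π (𝒢.tgt h, h) = h)
    (hπu : ∀ x y, (x, 𝒢.unit y) ∈ U → π (x, 𝒢.unit y) = 𝒢.unit x)
    {x : M} (hx : (x, 𝒢.unit x) ∈ U) (v : TangentSpace 𝓘(ℝ, EG) (𝒢.unit x)) :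
    (mfderiv 𝓘(ℝ, EG) 𝓘(ℝ, EG) (fun h => π (x, h)) (𝒢.unit x) v : EG)
      = 𝒢.leftLift x ((𝒢.unitTangent x).mkQ v) := by
  have htgt : ContMDiff 𝓘(ℝ, EG) 𝓘(ℝ, EM) ∞ 𝒢.tgt := 𝒢.tgt_submersion.contMDiff
  have hπd : MDifferentiableAt (𝓘(ℝ, EM).prod 𝓘(ℝ, EG)) 𝓘(ℝ, EG) π (x, 𝒢.unit x) :=
    (hπ.contMDiffAt (hU.mem_nhds hx)).mdifferentiableAt (by simp)
  have hsl : MDifferentiableAt 𝓘(ℝ, EG) 𝓘(ℝ, EG) (fun h => π (x, h)) (𝒢.unit x) :=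
    MDifferentiableAt.comp (𝒢.unit x) hπd
      (mdifferentiableAt_const.prodMk mdifferentiableAt_id)
  set D := mfderiv 𝓘(ℝ, EG) 𝓘(ℝ, EG) (fun h => π (x, h)) (𝒢.unit x) with hD
  have hunitd := (𝒢.contMDiff_unit x).mdifferentiableAt (by simp)
  have h1 : ∀ u, (D (𝒢.dUnit x u) : EG) = 0 := by
    intro u
    have hc := mfderiv_comp (I := 𝓘(ℝ, EM)) (I' := 𝓘(ℝ, EG)) (I'' := 𝓘(ℝ, EG)) x hsl hunitd
    have hev : (fun h => π (x, h)) ∘ 𝒢.unit =ᶠ[𝓝 x] fun _ => 𝒢.unit x := by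
      have hcont : ContinuousAt (fun y => (x, 𝒢.unit y)) x :=
        (continuous_const.prodMk 𝒢.contMDiff_unit.continuous).continuousAt
      filter_upwards [hcont.preimage_mem_nhds (hU.mem_nhds hx)] with y hy using hπu x y hy
    rw [hev.mfderiv_eq, mfderiv_const] at hc
    exact (DFunLike.congr_fun hc u).symm
  have h2 : ∀ w, 𝒢.dTgt x w = 0 → (D w : EG) = w := by
    intro w hw
    have hg : HasMFDerivAt 𝓘(ℝ, EG) (𝓘(ℝ, EM).prod 𝓘(ℝ, EG)) (fun h => (𝒢.tgt h, h)) (𝒢.unit x)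
        _ := ((htgt _).mdifferentiableAt (by simp)).hasMFDerivAt.prodMk (hasMFDerivAt_id _)
    have hx' : (𝒢.tgt (𝒢.unit x), 𝒢.unit x) = (x, 𝒢.unit x) := by rw [𝒢.tgt_unit]
    have hc := mfderiv_comp_apply_of_eq (f := fun h => (𝒢.tgt h, h)) (𝒢.unit x) hπd
      hg.mdifferentiableAt hx' w
    have hev : π ∘ (fun h => (𝒢.tgt h, h)) =ᶠ[𝓝 (𝒢.unit x)] id := by
      filter_upwards [hg.continuousAt.preimage_mem_nhds (hU.mem_nhds (by rwa [hx']))] with h hh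
        using hπid h hh
    rw [hev.mfderiv_eq, mfderiv_id, hg.mfderiv] at hc
    have hsum := mfderiv_prod_eq_add_apply (v := (show TangentSpace (𝓘(ℝ, EM).prod 𝓘(ℝ, EG)) (x, 𝒢.unit x) from
      ((𝒢.dTgt x w : EM), (w : EG)))) hπd
    have hzero : mfderiv 𝓘(ℝ, EM) 𝓘(ℝ, EG) (fun z => π (z, 𝒢.unit x)) x (𝒢.dTgt x w) = 0 := by
      rw [hw, map_zero]
    refine Eq.symm (Eq.trans (hc.trans hsum) ?_)
    exact (congrArg (fun a : EG => a + (show EG from D w)) hzero).trans (zero_add _)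
  have hv := 𝒢.leftLift_mk x v
  have hvv : (v : EG) = 𝒢.leftLift x ((𝒢.unitTangent x).mkQ v) + 𝒢.dUnit x (𝒢.dTgt x v) := by
    rw [hv]; exact (sub_add_cancel _ _).symm
  refine (congrArg D hvv).trans ((map_add D _ _).trans ?_)
  refine (congrArg₂ (fun a b : EG => a + b) (h2 _ (𝒢.dTgt_leftLift x _)) (h1 _)).trans ?_
  exact add_zero _

/-- The left-invariant field, computed through any representative of the section and any local
projection onto the target fibres. -/
theorem mfderiv_mul_fibreProj {U : Set (M × G)} {π : M × G → G} (hU : IsOpen U)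
    (hπ : ContMDiffOn (𝓘(ℝ, EM).prod 𝓘(ℝ, EG)) 𝓘(ℝ, EG) ∞ π U)
    (hπt : ∀ p ∈ U, 𝒢.tgt (π p) = p.1)
    (hπid : ∀ h, (𝒢.tgt h, h) ∈ U → π (𝒢.tgt h, h) = h)
    (hπu : ∀ x y, (x, 𝒢.unit y) ∈ U → π (x, 𝒢.unit y) = 𝒢.unit x)
    {g : G} (hg : (𝒢.src g, 𝒢.unit (𝒢.src g)) ∈ U) (X : ∀ x, 𝒢.AlgFibre x)
    (v : TangentSpace 𝓘(ℝ, EG) (𝒢.unit (𝒢.src g)))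
    (hv : X (𝒢.src g) = (𝒢.unitTangent (𝒢.src g)).mkQ v) :
    (mfderiv 𝓘(ℝ, EG) 𝓘(ℝ, EG) (fun h => 𝒢.mul g (π (𝒢.src g, h))) (𝒢.unit (𝒢.src g)) v : EG)
      = 𝒢.leftField X g := by
  have hπd : MDifferentiableAt (𝓘(ℝ, EM).prod 𝓘(ℝ, EG)) 𝓘(ℝ, EG) π (𝒢.src g, 𝒢.unit (𝒢.src g)) :=
    (hπ.contMDiffAt (hU.mem_nhds hg)).mdifferentiableAt (by simp)
  have hsl : MDifferentiableAt 𝓘(ℝ, EG) 𝓘(ℝ, EG) (fun h => π (𝒢.src g, h)) (𝒢.unit (𝒢.src g)) :=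
    MDifferentiableAt.comp (𝒢.unit (𝒢.src g)) hπd
      (mdifferentiableAt_const.prodMk mdifferentiableAt_id)
  have hmul : MDifferentiableWithinAt 𝓘(ℝ, EG) 𝓘(ℝ, EG) (fun h => 𝒢.mul g h)
      {h | 𝒢.tgt h = 𝒢.src g} (𝒢.unit (𝒢.src g)) := by
    have h1 := 𝒢.contMDiffOn_mul (g, 𝒢.unit (𝒢.src g)) (𝒢.tgt_unit (𝒢.src g)).symm
    have h2 : ContMDiffWithinAt 𝓘(ℝ, EG) (𝓘(ℝ, EG).prod 𝓘(ℝ, EG)) ∞ (fun h : G => (g, h))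
      {h | 𝒢.tgt h = 𝒢.src g} (𝒢.unit (𝒢.src g)) := contMDiffWithinAt_const.prodMk contMDiffWithinAt_id
    exact (h1.comp (𝒢.unit (𝒢.src g)) h2 fun h hh => Eq.symm hh).mdifferentiableWithinAt (by simp)
  have hpu : π (𝒢.src g, 𝒢.unit (𝒢.src g)) = 𝒢.unit (𝒢.src g) := hπu (𝒢.src g) (𝒢.src g) hg
  have hmul' : MDifferentiableWithinAt 𝓘(ℝ, EG) 𝓘(ℝ, EG) (fun h => 𝒢.mul g h)
      {h | 𝒢.tgt h = 𝒢.src g} (π (𝒢.src g, 𝒢.unit (𝒢.src g))) := by rwa [hpu]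
  have hcont : ContinuousAt (fun h => (𝒢.src g, h)) (𝒢.unit (𝒢.src g)) :=
    (continuous_const.prodMk continuous_id).continuousAt
  have hmem := hcont.preimage_mem_nhds (hU.mem_nhds hg)
  -- The projection maps a neighbourhood into the fibre, so the chain rule applies to the derivative
  -- within the fibre. Only the composite needs a unique derivative, and it has one.
  have hw : HasMFDerivWithinAt 𝓘(ℝ, EG) 𝓘(ℝ, EG) (fun h => 𝒢.mul g (π (𝒢.src g, h)))
      ((fun h => (𝒢.src g, h)) ⁻¹' U) (𝒢.unit (𝒢.src g)) _ :=
    HasMFDerivWithinAt.comp (𝒢.unit (𝒢.src g)) hmul'.hasMFDerivWithinAt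
      (hsl.hasMFDerivAt.hasMFDerivWithinAt (s := (fun h => (𝒢.src g, h)) ⁻¹' U)) fun h hh => hπt _ hh
  rw [(hw.hasMFDerivAt hmem).mfderiv]
  have hlift := 𝒢.mfderiv_fibreProj hU hπ hπid hπu hg v
  rw [← hv] at hlift
  -- Moves the base point along `hpu`; vectors are taken in the model space so that their type does
  -- not depend on `y`.
  have hstep : ∀ y : G, y = 𝒢.unit (𝒢.src g) → ∀ w : EG,
      (mfderivWithin 𝓘(ℝ, EG) 𝓘(ℝ, EG) (fun h => 𝒢.mul g h) {h | 𝒢.tgt h = 𝒢.src g} y w : EG)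
      = (mfderivWithin 𝓘(ℝ, EG) 𝓘(ℝ, EG) (fun h => 𝒢.mul g h) {h | 𝒢.tgt h = 𝒢.src g} (𝒢.unit (𝒢.src g)) w) := by
    rintro y rfl w; rfl
  refine (hstep _ hpu _).trans ?_
  exact congrArg (fun w : EG => (mfderivWithin 𝓘(ℝ, EG) 𝓘(ℝ, EG) (fun h => 𝒢.mul g h)
    {h | 𝒢.tgt h = 𝒢.src g} (𝒢.unit (𝒢.src g)) w : EG)) hlift

end Fields
end LieGroupoid

/-! ### Derivatives along smooth vector fields -/

section Deriv

variable {EG : Type*} [NormedAddCommGroup EG] [NormedSpace ℝ EG]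
  {G : Type*} [TopologicalSpace G] [ChartedSpace EG G] [IsManifold 𝓘(ℝ, EG) ∞ G]

/-- `V f` is the fibre component of the tangent map of `f` composed with `V`. -/
theorem ContMDiff.vfDeriv {V : ∀ g : G, TangentSpace 𝓘(ℝ, EG) g}
    (hV : ContMDiff 𝓘(ℝ, EG) 𝓘(ℝ, EG).tangent ∞
      (fun g => (⟨g, V g⟩ : TangentBundle 𝓘(ℝ, EG) G)))
    {f : G → ℝ} (hf : ContMDiff 𝓘(ℝ, EG) 𝓘(ℝ, ℝ) ∞ f) :
    ContMDiff 𝓘(ℝ, EG) 𝓘(ℝ, ℝ) ∞ (vfDeriv V f) := by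
  have : IsManifold 𝓘(ℝ, EG) 1 G := IsManifold.of_le (n := ∞) (by simp)
  exact (contMDiff_snd_tangentBundle_modelSpace ℝ 𝓘(ℝ, ℝ)).comp
    ((hf.contMDiff_tangentMap (m := ∞) (by simp)).comp hV)

end Deriv

/-! ### Tangency and smoothness of the invariant vector fields -/

namespace LieGroupoid

section Fields

variable {EM : Type*} [NormedAddCommGroup EM] [NormedSpace ℝ EM]
  {EG : Type*} [NormedAddCommGroup EG] [NormedSpace ℝ EG]
  {M : Type*} [TopologicalSpace M] [ChartedSpace EM M]
  {G : Type*} [TopologicalSpace G] [ChartedSpace EG G]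
  (𝒢 : LieGroupoid EM EG M G)

/-- Left-invariant vector fields are tangent to the target fibres. -/
theorem vfDeriv_leftField_congr (X : ∀ x, 𝒢.AlgFibre x) {f₁ f₂ : G → ℝ} {g : G}
    (h₁ : MDifferentiableAt 𝓘(ℝ, EG) 𝓘(ℝ, ℝ) f₁ g)
    (h₂ : MDifferentiableAt 𝓘(ℝ, EG) 𝓘(ℝ, ℝ) f₂ g)
    (h : ∀ k, 𝒢.tgt k = 𝒢.tgt g → f₁ k = f₂ k) :
    vfDeriv (𝒢.leftField X) f₁ g = vfDeriv (𝒢.leftField X) f₂ g := by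
  obtain ⟨U, π, hU, hgU, hπ, hπt, hπid, hπu⟩ := 𝒢.exists_fibreProj (𝒢.src g)
  obtain ⟨v, hv⟩ := (𝒢.unitTangent (𝒢.src g)).mkQ_surjective (X (𝒢.src g))
  have hfield := 𝒢.mfderiv_mul_fibreProj hU hπ hπt hπid hπu hgU X v hv.symm
  -- Near the unit, `c` takes values in the target fibre of `g`, and its derivative sends `v` to
  -- `X^L` at `g`. Hence `X^L f` at `g` only sees `f ∘ c`.
  let c : G → G := fun k => 𝒢.mul g (π (𝒢.src g, k))
  have hcu : c (𝒢.unit (𝒢.src g)) = g := by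
    simp only [c]; rw [hπu _ _ hgU, 𝒢.mul_unit]
  have hmem : (fun k => (𝒢.src g, k)) ⁻¹' U ∈ 𝓝 (𝒢.unit (𝒢.src g)) :=
    (continuous_const.prodMk continuous_id).continuousAt.preimage_mem_nhds (hU.mem_nhds hgU)
  have hc : MDifferentiableAt 𝓘(ℝ, EG) 𝓘(ℝ, EG) c (𝒢.unit (𝒢.src g)) := by
    have h1 : ContMDiffOn 𝓘(ℝ, EG) (𝓘(ℝ, EG).prod 𝓘(ℝ, EG)) ∞
        (fun k => (g, π (𝒢.src g, k))) ((fun k => (𝒢.src g, k)) ⁻¹' U) :=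
      contMDiffOn_const.prodMk
        (hπ.comp (contMDiff_const.prodMk contMDiff_id).contMDiffOn fun k hk => hk)
    have h2 := 𝒢.contMDiffOn_mul.comp h1 fun k hk => (hπt _ hk).symm
    exact (h2.contMDiffAt hmem).mdifferentiableAt (by simp)
  have hev : f₁ ∘ c =ᶠ[𝓝 (𝒢.unit (𝒢.src g))] f₂ ∘ c := by
    filter_upwards [hmem] with k hk
    exact h _ (𝒢.tgt_mul _ _ (hπt _ hk).symm)
  have key : ∀ f : G → ℝ, MDifferentiableAt 𝓘(ℝ, EG) 𝓘(ℝ, ℝ) f g →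
      vfDeriv (𝒢.leftField X) f g
        = mfderiv 𝓘(ℝ, EG) 𝓘(ℝ, ℝ) (f ∘ c) (𝒢.unit (𝒢.src g)) v := fun f hf => by
    refine Eq.trans ?_ (mfderiv_comp_apply_of_eq _ hf hc hcu v).symm
    exact congrArg (fun w : EG => (mfderiv 𝓘(ℝ, EG) 𝓘(ℝ, ℝ) f g w : ℝ)) hfield.symm
  rw [key f₁ h₁, key f₂ h₂]
  exact DFunLike.congr_fun hev.mfderiv_eq v

/-- Left translation by a unit is the identity on the target fibre, so only the derivative of the
projection remains. -/
theorem leftField_unit (X : ∀ x, 𝒢.AlgFibre x) (x : M) :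
    (𝒢.leftField X (𝒢.unit x) : EG) = 𝒢.leftLift x (X x) := by
  -- The base point is freed because `src (unit x)` and `x` are only propositionally equal, while
  -- the fibre types depend on them.
  have aux : ∀ (g : G) (x : M), 𝒢.src g = x → 𝒢.unit x = g →
      (𝒢.leftField X g : EG) = 𝒢.leftLift x (X x) := by
    rintro g _ rfl hg
    obtain ⟨U, π, hU, hgU, hπ, hπt, hπid, hπu⟩ := 𝒢.exists_fibreProj (𝒢.src g)
    obtain ⟨v, hv⟩ := (𝒢.unitTangent (𝒢.src g)).mkQ_surjective (X (𝒢.src g))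
    have hev : (fun h => 𝒢.mul g (π (𝒢.src g, h))) =ᶠ[𝓝 (𝒢.unit (𝒢.src g))]
        fun h => π (𝒢.src g, h) := by
      filter_upwards [(continuous_const.prodMk continuous_id).continuousAt.preimage_mem_nhds
        (hU.mem_nhds hgU)] with h hh
      have ht : 𝒢.tgt (π (𝒢.src g, h)) = 𝒢.src g := hπt _ hh
      have h1 := 𝒢.unit_mul (π (𝒢.src g, h))
      rw [ht] at h1
      exact (congrArg (fun k => 𝒢.mul k _) hg).symm.trans h1
    have h1 := 𝒢.mfderiv_mul_fibreProj hU hπ hπt hπid hπu hgU X v hv.symm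
    have h2 := 𝒢.mfderiv_fibreProj hU hπ hπid hπu hgU v
    rw [hv] at h2
    exact h1.symm.trans ((DFunLike.congr_fun hev.mfderiv_eq v).trans h2)
  exact aux _ x (𝒢.src_unit x) rfl

variable [IsManifold 𝓘(ℝ, EG) ∞ G]

/-- With `m (g, h) = g · π (src g, h)`, which is smooth on an open set, `X^L` at `g` is the tangent
map of `m` applied to the vector `(0, v (src g))` at `(g, unit (src g))`. The latter depends
smoothly on `g`. -/
theorem contMDiff_leftField {X : ∀ x, 𝒢.AlgFibre x} (hX : 𝒢.IsSmoothSection X) :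
    ContMDiff 𝓘(ℝ, EG) 𝓘(ℝ, EG).tangent ∞
      (fun g => (⟨g, 𝒢.leftField X g⟩ : TangentBundle 𝓘(ℝ, EG) G)) := by
  have : IsManifold 𝓘(ℝ, EG) 1 G := IsManifold.of_le (n := ∞) (by simp)
  intro g₀
  obtain ⟨U', hU', hxU', v, hv, hXv⟩ := hX (𝒢.src g₀) trivial
  obtain ⟨U, π, hU, hgU, hπ, hπt, hπid, hπu⟩ := 𝒢.exists_fibreProj (𝒢.src g₀)
  have hsrc : ContMDiff 𝓘(ℝ, EG) 𝓘(ℝ, EM) ∞ 𝒢.src := 𝒢.src_submersion.contMDiff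
  let V : Set (G × G) := (fun p : G × G => (𝒢.src p.1, p.2)) ⁻¹' U
  let m : G × G → G := fun p => 𝒢.mul p.1 (π (𝒢.src p.1, p.2))
  have hVo : IsOpen V := hU.preimage
    ((hsrc.continuous.comp continuous_fst).prodMk continuous_snd)
  have hm : ContMDiffOn (𝓘(ℝ, EG).prod 𝓘(ℝ, EG)) 𝓘(ℝ, EG) ∞ m V := by
    have h1 : ContMDiffOn (𝓘(ℝ, EG).prod 𝓘(ℝ, EG)) (𝓘(ℝ, EG).prod 𝓘(ℝ, EG)) ∞
        (fun p : G × G => (p.1, π (𝒢.src p.1, p.2))) V :=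
      contMDiffOn_fst.prodMk
        (hπ.comp ((hsrc.comp contMDiff_fst).prodMk contMDiff_snd).contMDiffOn fun k hk => hk)
    exact 𝒢.contMDiffOn_mul.comp h1 fun k hk => (hπt _ hk).symm
  let W : Set G := 𝒢.src ⁻¹' U' ∩ (fun g => (𝒢.src g, 𝒢.unit (𝒢.src g))) ⁻¹' U
  have hWo : IsOpen W := (hU'.preimage hsrc.continuous).inter
    (hU.preimage (hsrc.continuous.prodMk (𝒢.contMDiff_unit.continuous.comp hsrc.continuous)))
  let σ : G → TangentBundle (𝓘(ℝ, EG).prod 𝓘(ℝ, EG)) (G × G) := fun g =>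
    ⟨(g, 𝒢.unit (𝒢.src g)), ((0 : EG), (v (𝒢.src g) : EG))⟩
  have hσ : ContMDiffOn 𝓘(ℝ, EG) (𝓘(ℝ, EG).prod 𝓘(ℝ, EG)).tangent ∞ σ W := by
    have h0 : ContMDiffOn 𝓘(ℝ, EG) 𝓘(ℝ, EG).tangent ∞
        (fun g : G => (⟨g, 0⟩ : TangentBundle 𝓘(ℝ, EG) G)) W :=
      (Bundle.contMDiff_zeroSection ℝ (TangentSpace 𝓘(ℝ, EG) : G → Type _)).contMDiffOn
    have h1 : ContMDiffOn 𝓘(ℝ, EG) 𝓘(ℝ, EG).tangent ∞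
        (fun g => (⟨𝒢.unit (𝒢.src g), v (𝒢.src g)⟩ : TangentBundle 𝓘(ℝ, EG) G)) W :=
      hv.comp hsrc.contMDiffOn fun g hg => hg.1
    exact contMDiff_equivTangentBundleProd_symm.comp_contMDiffOn (h0.prodMk h1)
  have hT : ContMDiffOn 𝓘(ℝ, EG) 𝓘(ℝ, EG).tangent ∞
      (tangentMapWithin (𝓘(ℝ, EG).prod 𝓘(ℝ, EG)) 𝓘(ℝ, EG) m V ∘ σ) W :=
    (hm.contMDiffOn_tangentMapWithin (m := ∞) (by simp) hVo.uniqueMDiffOn).comp hσ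
      fun g hg => hg.2
  refine (hT.congr fun g hg => ?_).contMDiffAt (hWo.mem_nhds ⟨hxU', hgU⟩)
  have hmg : m (g, 𝒢.unit (𝒢.src g)) = g := by
    simp only [m]; rw [hπu _ _ hg.2, 𝒢.mul_unit]
  have hfield := 𝒢.mfderiv_mul_fibreProj hU hπ hπt hπid hπu hg.2 X (v (𝒢.src g)) (hXv _ hg.1)
  have hmd : MDifferentiableAt (𝓘(ℝ, EG).prod 𝓘(ℝ, EG)) 𝓘(ℝ, EG) m (g, 𝒢.unit (𝒢.src g)) :=
    (hm.contMDiffAt (hVo.mem_nhds hg.2)).mdifferentiableAt (by simp)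
  have hsum := mfderiv_prod_eq_add_apply
    (v := (show TangentSpace (𝓘(ℝ, EG).prod 𝓘(ℝ, EG)) (g, 𝒢.unit (𝒢.src g)) from
      ((0 : EG), (v (𝒢.src g) : EG)))) hmd
  have hval : (mfderivWithin (𝓘(ℝ, EG).prod 𝓘(ℝ, EG)) 𝓘(ℝ, EG) m V (g, 𝒢.unit (𝒢.src g))
      (show TangentSpace (𝓘(ℝ, EG).prod 𝓘(ℝ, EG)) (g, 𝒢.unit (𝒢.src g)) from
      ((0 : EG), (v (𝒢.src g) : EG))) : EG) = 𝒢.leftField X g := by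
    rw [mfderivWithin_of_isOpen hVo hg.2]
    refine hsum.trans (Eq.trans ?_ hfield)
    exact (congrArg (fun a : EG => a + _) (map_zero _)).trans (zero_add _)
  have hext : ∀ (y : G) (w w' : EG), y = g → w = w' →
      (⟨g, w'⟩ : TangentBundle 𝓘(ℝ, EG) G) = ⟨y, w⟩ := by
    rintro _ _ _ rfl rfl; rfl
  exact hext _ _ _ hmg hval

/-- Right-invariant fields are, by definitional unfolding, the left-invariant fields of `op`. -/
theorem contMDiff_rightField {X : ∀ x, 𝒢.AlgFibre x} (hX : 𝒢.IsSmoothSection X) :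
    ContMDiff 𝓘(ℝ, EG) 𝓘(ℝ, EG).tangent ∞
      (fun g => (⟨g, 𝒢.rightField X g⟩ : TangentBundle 𝓘(ℝ, EG) G)) :=
  𝒢.op.contMDiff_leftField hX

namespace ContrastFunction

variable {𝒢} (F : 𝒢.ContrastFunction)

/-- The function is the restriction of `X^L Y^L F` to the units. -/
theorem contMDiff_form {X Y : ∀ x, 𝒢.AlgFibre x} (hX : 𝒢.IsSmoothSection X)
    (hY : 𝒢.IsSmoothSection Y) :
    ContMDiff 𝓘(ℝ, EM) 𝓘(ℝ, ℝ) ∞ (fun x => F.form x (X x) (Y x)) := by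
  have h := ((𝒢.contMDiff_leftField hX).vfDeriv
    ((𝒢.contMDiff_leftField hY).vfDeriv F.contMDiff)).comp 𝒢.contMDiff_unit
  refine h.congr fun x => ?_
  have hV : ∀ Z : ∀ x, 𝒢.AlgFibre x,
      (𝒢.unitTangent x).mkQ (𝒢.leftField Z (𝒢.unit x)) = Z x := fun Z =>
    (congrArg (𝒢.unitTangent x).mkQ (𝒢.leftField_unit Z x)).trans (𝒢.mk_leftLift x (Z x))
  have := F.vfDeriv_vfDeriv_eq_form (𝒢.leftField X) (𝒢.leftField Y) x
    ((𝒢.contMDiff_leftField hY _).mdifferentiableAt (by simp))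
  rw [hV, hV] at this
  exact this.symm

end ContrastFunction

end Fields
end LieGroupoid

/-! ### Smooth sections of the Lie algebroid: combinations, cut-offs, extensions -/

namespace LieGroupoid

section Sections

variable {EM : Type*} [NormedAddCommGroup EM] [NormedSpace ℝ EM]
  {EG : Type*} [NormedAddCommGroup EG] [NormedSpace ℝ EG]
  {M : Type*} [TopologicalSpace M] [ChartedSpace EM M]
  {G : Type*} [TopologicalSpace G] [ChartedSpace EG G] [IsManifold 𝓘(ℝ, EG) ∞ G]
  {𝒢 : LieGroupoid EM EG M G}

theorem contMDiffOn_smul_add_lift {U : Set M} {v w : ∀ x, TangentSpace 𝓘(ℝ, EG) (𝒢.unit x)}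
    {a : M → ℝ} (ha : ContMDiffOn 𝓘(ℝ, EM) 𝓘(ℝ, ℝ) ∞ a U)
    (hv : ContMDiffOn 𝓘(ℝ, EM) 𝓘(ℝ, EG).tangent ∞
      (fun x => (⟨𝒢.unit x, v x⟩ : TangentBundle 𝓘(ℝ, EG) G)) U)
    (hw : ContMDiffOn 𝓘(ℝ, EM) 𝓘(ℝ, EG).tangent ∞
      (fun x => (⟨𝒢.unit x, w x⟩ : TangentBundle 𝓘(ℝ, EG) G)) U) :
    ContMDiffOn 𝓘(ℝ, EM) 𝓘(ℝ, EG).tangent ∞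
      (fun x => (⟨𝒢.unit x, a x • v x + w x⟩ : TangentBundle 𝓘(ℝ, EG) G)) U := by
  have : IsManifold 𝓘(ℝ, EG) 1 G := IsManifold.of_le (n := ∞) (by simp)
  intro x hx
  have hv' := (Bundle.contMDiffWithinAt_totalSpace.1 (hv x hx)).2
  have hw' := (Bundle.contMDiffWithinAt_totalSpace.1 (hw x hx)).2
  refine Bundle.contMDiffWithinAt_totalSpace.2 ⟨(𝒢.contMDiff_unit x).contMDiffWithinAt, ?_⟩
  refine (((ha x hx).smul hv').add hw').congr_of_eventuallyEq_of_mem ?_ hx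
  have hmem := 𝒢.contMDiff_unit.continuous.continuousAt.preimage_mem_nhds
    ((trivializationAt EG (TangentSpace 𝓘(ℝ, EG)) (𝒢.unit x)).open_baseSet.mem_nhds
      (FiberBundle.mem_baseSet_trivializationAt' (𝒢.unit x)))
  filter_upwards [nhdsWithin_le_nhds hmem] with y hy
  have hlin := (trivializationAt EG (TangentSpace 𝓘(ℝ, EG)) (𝒢.unit x)).linear ℝ hy
  change (trivializationAt EG (TangentSpace 𝓘(ℝ, EG)) (𝒢.unit x) ⟨𝒢.unit y, a y • v y + w y⟩).2 = _
  rw [hlin.map_add, hlin.map_smul]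
  rfl

theorem IsSmoothSectionOn.smul_add {U : Set M} (hU : IsOpen U) {X Y : ∀ x, 𝒢.AlgFibre x}
    {a : M → ℝ} (ha : ContMDiffOn 𝓘(ℝ, EM) 𝓘(ℝ, ℝ) ∞ a U)
    (hX : 𝒢.IsSmoothSectionOn U X) (hY : 𝒢.IsSmoothSectionOn U Y) :
    𝒢.IsSmoothSectionOn U (fun x => a x • X x + Y x) := by
  intro x₀ hx₀
  obtain ⟨U₁, hU₁, hx₁, v, hv, hXv⟩ := hX x₀ hx₀
  obtain ⟨U₂, hU₂, hx₂, w, hw, hYw⟩ := hY x₀ hx₀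
  refine ⟨U ∩ (U₁ ∩ U₂), hU.inter (hU₁.inter hU₂), ⟨hx₀, hx₁, hx₂⟩, fun x => a x • v x + w x,
    contMDiffOn_smul_add_lift (ha.mono Set.inter_subset_left) (hv.mono fun x hx => hx.2.1)
      (hw.mono fun x hx => hx.2.2), fun x hx => ?_⟩
  rw [map_add, map_smul, ← hXv x hx.2.1, ← hYw x hx.2.2]

theorem contMDiff_zero_lift : ContMDiff 𝓘(ℝ, EM) 𝓘(ℝ, EG).tangent ∞
    (fun x => (⟨𝒢.unit x, 0⟩ : TangentBundle 𝓘(ℝ, EG) G)) := by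
  have : IsManifold 𝓘(ℝ, EG) 1 G := IsManifold.of_le (n := ∞) (by simp)
  exact (Bundle.contMDiff_zeroSection ℝ (TangentSpace 𝓘(ℝ, EG) : G → Type _)).comp
    𝒢.contMDiff_unit

theorem isSmoothSectionOn_zero (U : Set M) :
    𝒢.IsSmoothSectionOn U (fun x => (0 : 𝒢.AlgFibre x)) := fun _ _ =>
  ⟨Set.univ, isOpen_univ, trivial, fun _ => 0, contMDiff_zero_lift.contMDiffOn, fun _ _ =>
    (map_zero _).symm⟩

theorem IsSmoothSectionOn.mono {U V : Set M} {X : ∀ x, 𝒢.AlgFibre x}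
    (hX : 𝒢.IsSmoothSectionOn V X) (h : U ⊆ V) : 𝒢.IsSmoothSectionOn U X :=
  fun x hx => hX x (h hx)

theorem IsSmoothSectionOn.sum {U : Set M} (hU : IsOpen U) {ι : Type*} (s : Finset ι)
    {X : ι → ∀ x, 𝒢.AlgFibre x} {a : ι → M → ℝ}
    (ha : ∀ i, ContMDiffOn 𝓘(ℝ, EM) 𝓘(ℝ, ℝ) ∞ (a i) U)
    (hX : ∀ i, 𝒢.IsSmoothSectionOn U (X i)) :
    𝒢.IsSmoothSectionOn U (fun x => ∑ i ∈ s, a i x • X i x) := by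
  classical
  induction s using Finset.induction_on with
  | empty => simpa using isSmoothSectionOn_zero U
  | insert i s hi ih =>
    simp only [Finset.sum_insert hi]
    exact IsSmoothSectionOn.smul_add hU (ha i) (hX i) ih

/-- Extension by zero. It turns local constructions into global sections, the only ones to which the
Koszul conditions apply. -/
theorem IsSmoothSectionOn.smul_of_tsupport_subset {U : Set M} (hU : IsOpen U)
    {X : ∀ x, 𝒢.AlgFibre x} (hX : 𝒢.IsSmoothSectionOn U X) {a : M → ℝ}
    (ha : ContMDiff 𝓘(ℝ, EM) 𝓘(ℝ, ℝ) ∞ a) (hs : tsupport a ⊆ U) :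
    𝒢.IsSmoothSection (fun x => a x • X x) := by
  intro x₀ _
  by_cases hx : x₀ ∈ U
  · simpa using IsSmoothSectionOn.smul_add hU ha.contMDiffOn hX (isSmoothSectionOn_zero U) x₀ hx
  · refine ⟨(tsupport a)ᶜ, (isClosed_tsupport a).isOpen_compl, fun h => hx (hs h), fun _ => 0,
      contMDiff_zero_lift.contMDiffOn, fun x hx => ?_⟩
    change a x • X x = (𝒢.unitTangent x).mkQ 0
    rw [image_eq_zero_of_notMem_tsupport hx, zero_smul, map_zero]

theorem exists_bump [FiniteDimensional ℝ EM] [T2Space M] [IsManifold 𝓘(ℝ, EM) ∞ M]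
    {U : Set M} (hU : IsOpen U) {x : M} (hx : x ∈ U) :
    ∃ a : M → ℝ, ContMDiff 𝓘(ℝ, EM) 𝓘(ℝ, ℝ) ∞ a ∧ tsupport a ⊆ U ∧ a x = 1 := by
  obtain ⟨f, -, hf⟩ := (SmoothBumpFunction.nhds_basis_tsupport (I := 𝓘(ℝ, EM)) x).mem_iff.1
    (hU.mem_nhds hx)
  exact ⟨f, f.contMDiff, hf, f.eq_one⟩

/-- A vector that is constant in a trivialization of `TG` is pulled back to the units and multiplied
by a bump function. -/
theorem exists_isSmoothSection_eq [FiniteDimensional ℝ EM] [T2Space M] [IsManifold 𝓘(ℝ, EM) ∞ M]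
    (x₀ : M) (z : 𝒢.AlgFibre x₀) :
    ∃ X : ∀ x, 𝒢.AlgFibre x, 𝒢.IsSmoothSection X ∧ X x₀ = z := by
  have : IsManifold 𝓘(ℝ, EG) 1 G := IsManifold.of_le (n := ∞) (by simp)
  obtain ⟨w, rfl⟩ := (𝒢.unitTangent x₀).mkQ_surjective z
  set e := trivializationAt EG (TangentSpace 𝓘(ℝ, EG)) (𝒢.unit x₀)
  have he : 𝒢.unit x₀ ∈ e.baseSet := FiberBundle.mem_baseSet_trivializationAt' _
  let U : Set M := 𝒢.unit ⁻¹' e.baseSet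
  have hU : IsOpen U := e.open_baseSet.preimage 𝒢.contMDiff_unit.continuous
  let v : ∀ x, TangentSpace 𝓘(ℝ, EG) (𝒢.unit x) := fun x => e.symm (𝒢.unit x) (e ⟨𝒢.unit x₀, w⟩).2
  have hv : ContMDiffOn 𝓘(ℝ, EM) 𝓘(ℝ, EG).tangent ∞
      (fun x => (⟨𝒢.unit x, v x⟩ : TangentBundle 𝓘(ℝ, EG) G)) U := by
    have h1 : ContMDiffOn 𝓘(ℝ, EM) (𝓘(ℝ, EG).prod 𝓘(ℝ, EG)) ∞
      (fun x => (𝒢.unit x, (e ⟨𝒢.unit x₀, w⟩).2)) U :=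
      𝒢.contMDiff_unit.contMDiffOn.prodMk contMDiffOn_const
    refine (e.contMDiffOn_symm.comp h1 fun x hx => ?_).congr fun x hx => e.mk_symm hx _
    rw [e.target_eq]
    exact ⟨hx, trivial⟩
  obtain ⟨a, ha, has, hax⟩ := exists_bump (EM := EM) hU (show x₀ ∈ U from he)
  refine ⟨_, IsSmoothSectionOn.smul_of_tsupport_subset hU
    (X := fun x => (𝒢.unitTangent x).mkQ (v x))
    (fun x hx => ⟨U, hU, hx, v, hv, fun _ _ => rfl⟩) ha has, ?_⟩
  have : v x₀ = w := e.symm_apply_apply_mk he w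
  simp only [hax, one_smul, this]

end Sections
end LieGroupoid

/-! ### Gram matrices of degenerate symmetric forms -/

section LinearAlgebra

variable {V : Type*} [AddCommGroup V] [Module ℝ V] [FiniteDimensional ℝ V] {r : ℕ}
  {B : V →ₗ[ℝ] V →ₗ[ℝ] ℝ}

/-- The invertible Gram matrix makes `z ↦ (B (e i) z)` onto `ℝ^r`. Its kernel contains that of `B`
and has the same dimension, since `B` has rank `r`; so the two coincide. -/
theorem LinearMap.mem_ker_of_gram_det_ne_zero (hB : ∀ a b, B a b = B b a)
    (hr : Module.finrank ℝ (LinearMap.range B) = r) {e : Fin r → V}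
    (he : (Matrix.of fun i j => B (e i) (e j)).det ≠ 0) {z : V} (hz : ∀ i, B (e i) z = 0) :
    z ∈ LinearMap.ker B := by
  let Φ : V →ₗ[ℝ] (Fin r → ℝ) := LinearMap.pi fun i => B (e i)
  have hΦ : LinearMap.range Φ = ⊤ := by
    rw [LinearMap.range_eq_top]
    intro b
    obtain ⟨c, hc⟩ := Matrix.mulVec_surjective_iff_isUnit.2
      ((Matrix.isUnit_iff_isUnit_det _).2 he.isUnit) b
    refine ⟨∑ j, c j • e j, funext fun i => ?_⟩
    have := congrFun hc i
    simpa [Φ, Matrix.mulVec, dotProduct, mul_comm] using this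
  have hle : LinearMap.ker B ≤ LinearMap.ker Φ := fun k hk =>
    LinearMap.mem_ker.2 (funext fun i => by
      change B (e i) k = 0
      rw [hB, LinearMap.mem_ker.1 hk, LinearMap.zero_apply])
  have h1 := LinearMap.finrank_range_add_finrank_ker B
  have h2 := LinearMap.finrank_range_add_finrank_ker Φ
  rw [hΦ, finrank_top, Module.finrank_fin_fun] at h2
  rw [Submodule.eq_of_le_of_finrank_eq hle (by omega)]
  exact LinearMap.mem_ker.2 (funext hz)

/-- Take a basis of a complement `C` of the kernel. A null vector of its Gram matrix gives `s` in
`C` orthogonal to `C` and to the kernel, hence to everything; then `s` lies in both summands and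
vanishes. -/
theorem LinearMap.exists_gram_det_ne_zero (hB : ∀ a b, B a b = B b a)
    (hr : Module.finrank ℝ (LinearMap.range B) = r) :
    ∃ e : Fin r → V, (Matrix.of fun i j => B (e i) (e j)).det ≠ 0 := by
  obtain ⟨C, hC⟩ := (LinearMap.ker B).exists_isCompl
  have h1 := LinearMap.finrank_range_add_finrank_ker B
  have h2 := Submodule.finrank_add_eq_of_isCompl hC
  let b := Module.finBasisOfFinrankEq ℝ C (show Module.finrank ℝ C = r by omega)
  refine ⟨fun i => b i, fun hdet => ?_⟩
  obtain ⟨c, hc, hc0⟩ := Matrix.exists_mulVec_eq_zero_iff.2 hdet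
  refine hc (funext fun i => ?_)
  let s : C := ∑ j, c j • b j
  have hbs : ∀ i, B (b i) s = 0 := fun i => by
    have := congrFun hc0 i
    simpa [s, Matrix.mulVec, dotProduct, mul_comm] using this
  have hCs : C ≤ LinearMap.ker (B s) := by
    have : Submodule.map C.subtype (Submodule.span ℝ (Set.range b)) ≤ LinearMap.ker (B s) := by
      rw [Submodule.map_span_le]
      rintro _ ⟨i, rfl⟩
      exact LinearMap.mem_ker.2 ((hB _ _).trans (hbs i))
    rwa [b.span_eq, Submodule.map_top, Submodule.range_subtype] at this
  have hKs : LinearMap.ker B ≤ LinearMap.ker (B s) := fun k hk =>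
    LinearMap.mem_ker.2 (by rw [hB, LinearMap.mem_ker.1 hk, LinearMap.zero_apply])
  have hs : (s : V) ∈ LinearMap.ker B := LinearMap.mem_ker.2
    (LinearMap.ker_eq_top.1 (top_le_iff.1 (hC.sup_eq_top ▸ sup_le hKs hCs)))
  have hs0 : s = 0 := Subtype.ext (Submodule.disjoint_def.1 hC.disjoint _ hs s.2)
  exact Fintype.linearIndependent_iff.1 b.linearIndependent c hs0 i

end LinearAlgebra

section Det

variable {EM : Type*} [NormedAddCommGroup EM] [NormedSpace ℝ EM]
  {M : Type*} [TopologicalSpace M] [ChartedSpace EM M]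

theorem contMDiff_matrix_det {r : ℕ} {A : M → Matrix (Fin r) (Fin r) ℝ}
    (hA : ∀ i j, ContMDiff 𝓘(ℝ, EM) 𝓘(ℝ, ℝ) ∞ fun x => A x i j) :
    ContMDiff 𝓘(ℝ, EM) 𝓘(ℝ, ℝ) ∞ fun x => (A x).det := by
  simp only [Matrix.det_apply']
  exact contMDiff_finsetSum fun σ _ => contMDiff_const.mul (contMDiff_finsetProd fun i _ => hA _ _)

end Det

/-! ### Local frames of the quotient bundle and sections of the kernel -/

namespace LieGroupoid

section Frame

variable {EM : Type*} [NormedAddCommGroup EM] [NormedSpace ℝ EM]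
  {EG : Type*} [NormedAddCommGroup EG] [NormedSpace ℝ EG]
  {M : Type*} [TopologicalSpace M] [ChartedSpace EM M]
  {G : Type*} [TopologicalSpace G] [ChartedSpace EG G] [IsManifold 𝓘(ℝ, EG) ∞ G]
  {𝒢 : LieGroupoid EM EG M G}

namespace ContrastFunction

variable (F : 𝒢.ContrastFunction) [FiniteDimensional ℝ EM] [FiniteDimensional ℝ EG] [T2Space M]
  [IsManifold 𝓘(ℝ, EM) ∞ M]

/-- For a regular contrast function there are, near each point, sections of `E` that form a frame
of `L^F`: sections are determined modulo `K^F` by their products with the frame, and these products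
can be prescribed. -/
theorem exists_quotFrame (hF : F.IsRegular) (x₀ : M) :
    ∃ (r : ℕ) (U : Set M) (e : Fin r → ∀ x, 𝒢.AlgFibre x), IsOpen U ∧ x₀ ∈ U ∧
      (∀ i, 𝒢.IsSmoothSection (e i)) ∧
      (∀ x ∈ U, ∀ z, (∀ i, F.form x (e i x) z = 0) → z ∈ F.ker x) ∧
      ∀ b : Fin r → M → ℝ, (∀ i, ContMDiff 𝓘(ℝ, EM) 𝓘(ℝ, ℝ) ∞ (b i)) →
        ∃ c : Fin r → M → ℝ, (∀ i, ContMDiffOn 𝓘(ℝ, EM) 𝓘(ℝ, ℝ) ∞ (c i) U) ∧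
          (∀ x ∈ U, ∀ i, F.form x (e i x) (∑ j, c j x • e j x) = b i x) ∧
          ∀ x, (∀ i, b i x = 0) → ∀ i, c i x = 0 := by
  obtain ⟨r, hr⟩ := hF
  have hfin : ∀ x, FiniteDimensional ℝ (𝒢.AlgFibre x) := fun x =>
    have : FiniteDimensional ℝ (TangentSpace 𝓘(ℝ, EG) (𝒢.unit x)) :=
      inferInstanceAs (FiniteDimensional ℝ EG)
    inferInstance
  obtain ⟨z, hz⟩ := LinearMap.exists_gram_det_ne_zero (F.form_symm x₀) (hr x₀)
  choose e he hez using fun i => exists_isSmoothSection_eq (𝒢 := 𝒢) x₀ (z i)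
  let A : M → Matrix (Fin r) (Fin r) ℝ := fun x => Matrix.of fun i j => F.form x (e i x) (e j x)
  have hA : ∀ i j, ContMDiff 𝓘(ℝ, EM) 𝓘(ℝ, ℝ) ∞ fun x => A x i j := fun i j =>
    F.contMDiff_form (he i) (he j)
  have hdet := contMDiff_matrix_det hA
  -- The coefficients solve the Gram system by Cramer's rule. They are linear in `b` at each point,
  -- so they vanish wherever `b` does.
  refine ⟨r, {x | (A x).det ≠ 0}, e, hdet.continuous.isOpen_preimage _ isOpen_compl_singleton,
    by simpa [A, hez] using hz, he,
    fun x hx z hz => LinearMap.mem_ker_of_gram_det_ne_zero (F.form_symm x) (hr x) hx hz,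
    fun b hb => ⟨fun i x => (A x).det⁻¹ * (A x).cramer (fun j => b j x) i, fun i => ?_, ?_, ?_⟩⟩
  · refine ContMDiffOn.mul (fun x hx => (hdet x).contMDiffWithinAt.inv₀ hx) ?_
    simp only [Matrix.cramer_apply]
    refine (contMDiff_matrix_det fun k l => ?_).contMDiffOn
    by_cases h : l = i
    · subst h; simpa using hb k
    · simpa [Matrix.updateCol_ne h] using hA k l
  · intro x hx i
    have h := congrFun ((A x).mulVec_cramer fun j => b j x) i
    simp only [map_sum, map_smul, smul_eq_mul]
    simp only [Matrix.mulVec, dotProduct, Pi.smul_apply, smul_eq_mul] at h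
    rw [← inv_mul_cancel_left₀ hx (b i x), ← h, Finset.mul_sum]
    exact Finset.sum_congr rfl fun j _ => by simp only [A, Matrix.of_apply]; ring
  · intro x hb i
    have : (fun j => b j x) = 0 := funext hb
    simp [this]

/-- From any section through `k`, subtract its `g^F`-projection to the span of the frame. The
difference lies in `K^F` near `x₀`, and nothing is subtracted at `x₀` because `k` is already in the
kernel. A bump function makes the result global. -/
theorem exists_ker_section (hF : F.IsRegular) (x₀ : M) {k : 𝒢.AlgFibre x₀} (hk : k ∈ F.ker x₀) :
    ∃ Z : ∀ x, 𝒢.AlgFibre x, 𝒢.IsSmoothSection Z ∧ (∀ x, Z x ∈ F.ker x) ∧ Z x₀ = k := by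
  obtain ⟨r, U, e, hU, hxU, he, hker, hsol⟩ := F.exists_quotFrame hF x₀
  obtain ⟨Z, hZ, rfl⟩ := exists_isSmoothSection_eq x₀ k
  obtain ⟨c, hc, hce, hc0⟩ := hsol (fun i x => F.form x (e i x) (Z x)) fun i =>
    F.contMDiff_form (he i) hZ
  obtain ⟨a, ha, has, hax⟩ := exists_bump (EM := EM) hU hxU
  let Y : ∀ x, 𝒢.AlgFibre x := fun x => (-1 : ℝ) • (∑ j, c j x • e j x) + Z x
  have hY : 𝒢.IsSmoothSectionOn U Y := IsSmoothSectionOn.smul_add hU contMDiffOn_const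
    (IsSmoothSectionOn.sum hU _ hc fun i => (he i).mono (Set.subset_univ _))
    (hZ.mono (Set.subset_univ _))
  refine ⟨_, hY.smul_of_tsupport_subset hU ha has, fun x => ?_, ?_⟩
  · by_cases hx : x ∈ U
    · refine Submodule.smul_mem _ _ (hker x hx _ fun i => ?_)
      simp only [Y, map_add, map_smul, hce x hx i]
      simp
    · rw [image_eq_zero_of_notMem_tsupport fun h => hx (has h), zero_smul]
      exact Submodule.zero_mem _
  · have h0 := hc0 x₀ fun i => by rw [F.form_symm, LinearMap.mem_ker.1 hk, LinearMap.zero_apply]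
    simp [Y, hax, h0]

end ContrastFunction
end Frame
end LieGroupoid

/-! ### Tensoriality of the third derivative and its representing section -/

namespace LieGroupoid

section ThirdDerivative

variable {EM : Type*} [NormedAddCommGroup EM] [NormedSpace ℝ EM]
  {EG : Type*} [NormedAddCommGroup EG] [NormedSpace ℝ EG]
  {M : Type*} [TopologicalSpace M] [ChartedSpace EM M]
  {G : Type*} [TopologicalSpace G] [ChartedSpace EG G]
  {𝒢 : LieGroupoid EM EG M G}

variable (𝒢) in
/-- The third derivative `X^L Y^L Z^R H` along the units. -/
noncomputable def thirdDeriv (X Y : ∀ x, 𝒢.AlgFibre x) (H : G → ℝ) (Z : ∀ x, 𝒢.AlgFibre x) (x : M) : ℝ :=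
  vfDeriv (𝒢.leftField X) (vfDeriv (𝒢.leftField Y) (vfDeriv (𝒢.rightField Z) H)) (𝒢.unit x)

theorem vfDeriv_rightField_smul_add (a : ℝ) (Z Z' : ∀ x, 𝒢.AlgFibre x) (H : G → ℝ) :
    vfDeriv (𝒢.rightField fun x => a • Z x + Z' x) H
      = a • vfDeriv (𝒢.rightField Z) H + vfDeriv (𝒢.rightField Z') H := by
  funext g
  have key : ∀ (L : EG →L[ℝ] ℝ) (D : EG →L[ℝ] EG) (R : 𝒢.AlgFibre (𝒢.tgt g) →ₗ[ℝ] EG)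
      (z z' : 𝒢.AlgFibre (𝒢.tgt g)), L (D (R (a • z + z'))) = a • L (D (R z)) + L (D (R z')) := by
    intro L D R z z'
    simp only [map_add, map_smul]
  exact key _ _ (𝒢.rightLift (𝒢.tgt g)) _ _

theorem vfDeriv_smul_add (V : ∀ g : G, TangentSpace 𝓘(ℝ, EG) g) (a : ℝ) {f f' : G → ℝ}
    (hf : ContMDiff 𝓘(ℝ, EG) 𝓘(ℝ, ℝ) ∞ f) (hf' : ContMDiff 𝓘(ℝ, EG) 𝓘(ℝ, ℝ) ∞ f') :
    vfDeriv V (a • f + f') = a • vfDeriv V f + vfDeriv V f' := by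
  funext g
  have h := ((hf.mdifferentiableAt (by simp) (x := g)).hasMFDerivAt.const_smul a).add
    (hf'.mdifferentiableAt (by simp) (x := g)).hasMFDerivAt
  exact DFunLike.congr_fun h.mfderiv (V g)

variable [IsManifold 𝓘(ℝ, EG) ∞ G] {X Y : ∀ x, 𝒢.AlgFibre x} {H : G → ℝ}

theorem contMDiff_thirdDeriv (hX : 𝒢.IsSmoothSection X) (hY : 𝒢.IsSmoothSection Y)
    (hH : ContMDiff 𝓘(ℝ, EG) 𝓘(ℝ, ℝ) ∞ H) {Z : ∀ x, 𝒢.AlgFibre x} (hZ : 𝒢.IsSmoothSection Z) :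
    ContMDiff 𝓘(ℝ, EM) 𝓘(ℝ, ℝ) ∞ (𝒢.thirdDeriv X Y H Z) :=
  ((𝒢.contMDiff_leftField hX).vfDeriv ((𝒢.contMDiff_leftField hY).vfDeriv
    ((𝒢.contMDiff_rightField hZ).vfDeriv hH))).comp 𝒢.contMDiff_unit

theorem thirdDeriv_smul_add (hY : 𝒢.IsSmoothSection Y) (hH : ContMDiff 𝓘(ℝ, EG) 𝓘(ℝ, ℝ) ∞ H)
    (a : ℝ) {Z Z' : ∀ x, 𝒢.AlgFibre x} (hZ : 𝒢.IsSmoothSection Z)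
    (hZ' : 𝒢.IsSmoothSection Z') (x : M) :
    𝒢.thirdDeriv X Y H (fun x => a • Z x + Z' x) x
      = a * 𝒢.thirdDeriv X Y H Z x + 𝒢.thirdDeriv X Y H Z' x := by
  have h := (𝒢.contMDiff_rightField hZ).vfDeriv hH
  have h' := (𝒢.contMDiff_rightField hZ').vfDeriv hH
  unfold thirdDeriv
  rw [vfDeriv_rightField_smul_add, vfDeriv_smul_add _ _ h h',
    vfDeriv_smul_add _ _ ((𝒢.contMDiff_leftField hY).vfDeriv h)
      ((𝒢.contMDiff_leftField hY).vfDeriv h')]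
  rfl

/-- `X^L Y^L Z^R H` is tensorial in `Z`, because left-invariant fields are tangent to the target
fibres and `Z^R H` depends at `g` only on the value of `Z` at the target of `g`. -/
theorem thirdDeriv_congr (hY : 𝒢.IsSmoothSection Y) (hH : ContMDiff 𝓘(ℝ, EG) 𝓘(ℝ, ℝ) ∞ H)
    {Z Z' : ∀ x, 𝒢.AlgFibre x} (hZ : 𝒢.IsSmoothSection Z)
    (hZ' : 𝒢.IsSmoothSection Z') {x : M} (h : Z x = Z' x) :
    𝒢.thirdDeriv X Y H Z x = 𝒢.thirdDeriv X Y H Z' x := by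
  have hs := (𝒢.contMDiff_rightField hZ).vfDeriv hH
  have hs' := (𝒢.contMDiff_rightField hZ').vfDeriv hH
  have h1 : ∀ g, 𝒢.tgt g = x →
      vfDeriv (𝒢.rightField Z) H g = vfDeriv (𝒢.rightField Z') H g := by
    rintro g rfl
    simp only [vfDeriv, rightField, h]
    rfl
  have h2 : ∀ g, 𝒢.tgt g = x → vfDeriv (𝒢.leftField Y) (vfDeriv (𝒢.rightField Z) H) g
      = vfDeriv (𝒢.leftField Y) (vfDeriv (𝒢.rightField Z') H) g := fun g hg =>
    𝒢.vfDeriv_leftField_congr Y (hs.mdifferentiableAt (by simp))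
      (hs'.mdifferentiableAt (by simp)) fun k hk => h1 k (hk.trans hg)
  exact 𝒢.vfDeriv_leftField_congr X
    (((𝒢.contMDiff_leftField hY).vfDeriv hs).mdifferentiableAt (by simp))
    (((𝒢.contMDiff_leftField hY).vfDeriv hs').mdifferentiableAt (by simp))
    fun k hk => h2 k (hk.trans (𝒢.tgt_unit x))

variable [FiniteDimensional ℝ EM] [T2Space M] [IsManifold 𝓘(ℝ, EM) ∞ M]

/-- By tensoriality the value may be computed with any extension `S z` of a vector `z`, and `S (a •
z + z')` agrees at `x` with `a • S z + S z'`. -/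
theorem exists_thirdDeriv_linear (hY : 𝒢.IsSmoothSection Y) (hH : ContMDiff 𝓘(ℝ, EG) 𝓘(ℝ, ℝ) ∞ H)
    (x : M) : ∃ T : 𝒢.AlgFibre x →ₗ[ℝ] ℝ,
    ∀ Z, 𝒢.IsSmoothSection Z → 𝒢.thirdDeriv X Y H Z x = T (Z x) := by
  choose S hS hSx using exists_isSmoothSection_eq (𝒢 := 𝒢) x
  have hadd : ∀ (a : ℝ) (z z' : 𝒢.AlgFibre x), 𝒢.thirdDeriv X Y H (S (a • z + z')) x
      = a * 𝒢.thirdDeriv X Y H (S z) x + 𝒢.thirdDeriv X Y H (S z') x := fun a z z' => by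
    rw [← thirdDeriv_smul_add hY hH a (hS z) (hS z') x]
    exact thirdDeriv_congr hY hH (hS _)
      (IsSmoothSectionOn.smul_add isOpen_univ contMDiffOn_const (hS z) (hS z')) (by simp only [hSx])
  have hzero : 𝒢.thirdDeriv X Y H (S 0) x = 0 := by simpa using hadd 1 0 0
  refine ⟨{ toFun := fun z => 𝒢.thirdDeriv X Y H (S z) x
            map_add' := fun z z' => by simpa using hadd 1 z z'
            map_smul' := fun a z => by simpa [hzero] using hadd a z 0 }, fun Z hZ =>
    thirdDeriv_congr hY hH hZ (hS _) (hSx _).symm⟩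

/-- If `X^L Y^L Z^R H` vanishes on sections `Z` of `K^F`, then it is represented by a unique section
of `L^F`. -/
theorem existsUnique_transMetric_eq_thirdDeriv [FiniteDimensional ℝ EG]
    (hX : 𝒢.IsSmoothSection X) (hY : 𝒢.IsSmoothSection Y)
    (hH : ContMDiff 𝓘(ℝ, EG) 𝓘(ℝ, ℝ) ∞ H) (F : 𝒢.ContrastFunction)
    (hF : F.IsRegular)
    (hvan : ∀ Z, 𝒢.IsSmoothSection Z → (∀ x, Z x ∈ F.ker x) → ∀ x, 𝒢.thirdDeriv X Y H Z x = 0) :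
    ∃! W : ∀ x, F.QuotFibre x, F.IsSmoothQuotSection W ∧
      ∀ Z : ∀ x, 𝒢.AlgFibre x, 𝒢.IsSmoothSection Z → ∀ x,
        F.transMetric x (W x) ((F.ker x).mkQ (Z x)) = 𝒢.thirdDeriv X Y H Z x := by
  choose T hT using exists_thirdDeriv_linear (X := X) hY hH
  have hTker : ∀ x, ∀ k ∈ F.ker x, T x k = 0 := fun x k hk => by
    obtain ⟨Z, hZ, hZk, rfl⟩ := F.exists_ker_section hF x hk
    rw [← hT x Z hZ, hvan Z hZ hZk]
  have hloc : ∀ x₀, ∃ U : Set M, IsOpen U ∧ x₀ ∈ U ∧ ∃ w : ∀ x, 𝒢.AlgFibre x,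
      𝒢.IsSmoothSectionOn U w ∧ ∀ x ∈ U, ∀ z, F.form x (w x) z = T x z := by
    intro x₀
    obtain ⟨r, U, e, hU, hxU, he, hker, hsol⟩ := F.exists_quotFrame hF x₀
    obtain ⟨c, hc, hce, -⟩ := hsol (fun i => 𝒢.thirdDeriv X Y H (e i)) fun i =>
      contMDiff_thirdDeriv hX hY hH (he i)
    refine ⟨U, hU, hxU, fun x => ∑ j, c j x • e j x,
      IsSmoothSectionOn.sum hU _ hc fun i => (he i).mono (Set.subset_univ _), fun x hx z => ?_⟩
    -- Only the value at `x` matters here: constant right-hand sides give the frame coefficients `d`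
    -- of `z` modulo `K^F`. Both `T x` and the form kill the remainder, so it suffices to compare
    -- them on the frame.
    obtain ⟨d, -, hde, -⟩ := hsol (fun i _ => F.form x (e i x) z) fun i => contMDiff_const
    have hz : z - ∑ j, d j x • e j x ∈ F.ker x := hker x hx _ fun i => by
      rw [(F.form x (e i x)).map_sub, hde x hx i, sub_self]
    have h1 := hTker x _ hz
    have h2 : F.form x (∑ j, c j x • e j x) (z - ∑ j, d j x • e j x) = 0 := by
      rw [F.form_symm, LinearMap.mem_ker.1 hz, LinearMap.zero_apply]
    rw [LinearMap.map_sub, sub_eq_zero] at h1 h2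
    rw [h1, h2, map_sum (T x), map_sum (F.form x (∑ j, c j x • e j x))]
    refine Finset.sum_congr rfl fun i _ => ?_
    rw [map_smul, map_smul, F.form_symm, hce x hx i, hT x _ (he i)]
  have hnd : ∀ x (q q' : F.QuotFibre x),
      (∀ z, F.transMetric x q ((F.ker x).mkQ z) = F.transMetric x q' ((F.ker x).mkQ z)) →
      q = q' := by
    intro x q q' h
    obtain ⟨a, rfl⟩ := (F.ker x).mkQ_surjective q
    obtain ⟨a', rfl⟩ := (F.ker x).mkQ_surjective q'
    rw [← sub_eq_zero, ← map_sub, Submodule.mkQ_apply, Submodule.Quotient.mk_eq_zero]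
    refine LinearMap.mem_ker.2 (LinearMap.ext fun z => ?_)
    rw [map_sub, LinearMap.sub_apply, ← F.transMetric_mk, ← F.transMetric_mk, h, sub_self]
    rfl
  choose U hU hxU w hw hwT using hloc
  have hW : ∀ x z, F.transMetric x ((F.ker x).mkQ (w x x)) ((F.ker x).mkQ z) = T x z :=
    fun x z => hwT x x (hxU x) z
  -- Each point uses its own local solution. Near `x₀` non-degeneracy identifies these with the
  -- single smooth solution `w x₀`, so no partition of unity is needed.
  refine ⟨fun x => (F.ker x).mkQ (w x x), ⟨fun x₀ => ⟨U x₀, hU x₀, hxU x₀, w x₀, hw x₀,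
    fun x hx => hnd x _ _ fun z => ?_⟩, fun Z hZ x => ?_⟩, fun W' hW' => funext fun x =>
      hnd x _ _ fun z => ?_⟩
  · rw [hW, F.transMetric_mk, hwT x₀ x hx]
  · rw [hW, hT x Z hZ]
  · obtain ⟨Z, hZ, rfl⟩ := exists_isSmoothSection_eq x z
    rw [hW, hW'.2 Z hZ x, hT x Z hZ]

end ThirdDerivative

end LieGroupoid

theorem mainTheorem8
    {EM : Type*} [NormedAddCommGroup EM] [NormedSpace ℝ EM] [FiniteDimensional ℝ EM]
    {EG : Type*} [NormedAddCommGroup EG] [NormedSpace ℝ EG] [FiniteDimensional ℝ EG]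
    {M : Type*} [TopologicalSpace M] [ChartedSpace EM M] [IsManifold 𝓘(ℝ, EM) ∞ M]
    [T2Space M]
    {G : Type*} [TopologicalSpace G] [ChartedSpace EG G] [IsManifold 𝓘(ℝ, EG) ∞ G]
    (𝒢 : LieGroupoid EM EG M G) (F : 𝒢.ContrastFunction) (hF : F.IsKoszul)
    (X Y : ∀ x, 𝒢.AlgFibre x) (hX : 𝒢.IsSmoothSection X) (hY : 𝒢.IsSmoothSection Y) :
    (∃! W : ∀ x, F.QuotFibre x, F.IsSmoothQuotSection W ∧
      ∀ Z : ∀ x, 𝒢.AlgFibre x, 𝒢.IsSmoothSection Z → ∀ x,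
        F.transMetric x (W x) ((F.ker x).mkQ (Z x)) =
          vfDeriv (𝒢.leftField X) (vfDeriv (𝒢.leftField Y)
            (vfDeriv (𝒢.rightField Z) F.toFun)) (𝒢.unit x)) ∧
    (∃! W : ∀ x, F.QuotFibre x, F.IsSmoothQuotSection W ∧
      ∀ Z : ∀ x, 𝒢.AlgFibre x, 𝒢.IsSmoothSection Z → ∀ x,
        F.transMetric x (W x) ((F.ker x).mkQ (Z x)) =
          vfDeriv (𝒢.leftField X) (vfDeriv (𝒢.leftField Y)
            (vfDeriv (𝒢.rightField Z) F.dual)) (𝒢.unit x)) := by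

  -- Both halves use the kernel and metric of `F` itself; of `F ∘ inv` only smoothness and the
  -- second Koszul condition enter.
  exact ⟨LieGroupoid.existsUnique_transMetric_eq_thirdDeriv hX hY F.contMDiff F hF.regular
      fun Z hZ hk => hF.left X Y Z hX hY hZ hk,
    LieGroupoid.existsUnique_transMetric_eq_thirdDeriv hX hY
      (F.contMDiff.comp 𝒢.contMDiff_inv) F hF.regular
      fun Z hZ hk => hF.right X Y Z hX hY hZ hk⟩
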